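/- Let $n\ge 1$ and let $\Omega\subset\mathbb{R}^n$ be a connected open set that equals the interior of its closure (as holds for an open set with piecewise $\mathscr{C}^1$ boundary lying locally on one side of its boundary). Let $\mu$ be a probability measure on $\Omega$ having a density with respect to the Lebesgue measure that is positive on $\Omega$, and let $\mu_1,\dots,\mu_n$ be its one-dimensional marginals, with cumulative distribution functions $F_1,\dots,F_n$. Let $\Sigma$ be a real symmetric positive definite $n\times n$ matrix with $\Sigma_{i,i}=1$ for all $i$ and $\Sigma_{i,j}\in(-1,1)$ for $i\ne j$. Assume that $\mu$ has the Gaussian copula $\mathcal{C}_\Sigma$, that is, $$\mu\Big(\prod_{i=1}^n(-\infty,x_i]\Big)=\mathcal{C}_\Sigma\big(F_1(x_1),\dots,F_n(x_n)\big)\qquad\text{for all }x\in\mathbb{R}^n,$$ where $\mathcal{C}_\Sigma(u)=\mathbb{P}\big(\Phi(Y_1)\le u_1,\dots,\Phi(Y_n)\le u_n\big)$ with $Y\sim\mathcal{N}(0,\Sigma)$ and $\Phi$ the cumulative distribution function of $\mathcal{N}(0,1)$. Assume that each marginal is uniformly log-concave: for each $i$ there are a constant $\kappa_i>0$, an open interval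 $I_i\subset\mathbb{R}$ and a twice differentiable function $V_i\colon I_i\to\mathbb{R}$ with $V_i''\ge\kappa_i$ on $I_i$, such that $\mu_i$ has density $e^{-V_i}$ on $I_i$ and $0$ outside $I_i$. Then $\mu$ satisfies a classical Poincaré inequality: there is a smallest constant $C_P(\mu)\in(0,\infty)$ such that $$\mathrm{Var}_\mu(f)\le C_P(\mu)\int_\Omega\|\nabla f\|^2\,d\mu$$ for every $f\in L^2(\mu)$ that is locally integrable on $\Omega$ and has a locally integrable weak gradient $\nabla f$ on $\Omega$ with $\int_\Omega\|\nabla f\|^2\,d\mu<\infty$. Moreover $$C_P(\mu)\le\lambda_{\max}(\Sigma)\,\max_{1\le i\le n}\frac1{\kappa_i},$$ where $\lambda_{\max}(\Sigma)$ is the largest eigenvalue of $\Sigma$. -/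

import Mathlib

open MeasureTheory ProbabilityTheory
open scoped ContDiff

noncomputable section

/-- The class `𝓟(Ω)`: probability measures on `Ω` with a density with respect to the Lebesgue
measure which is positive on `Ω`. -/
def MemProbClass {n : ℕ} (Ω : Set (EuclideanSpace ℝ (Fin n)))
    (μ : Measure (EuclideanSpace ℝ (Fin n))) : Prop :=
  IsProbabilityMeasure μ ∧ ∃ ρ : EuclideanSpace ℝ (Fin n) → ℝ, Measurable ρ ∧
    (∀ x ∈ Ω, 0 < ρ x) ∧
    μ = (volume.restrict Ω).withDensity (fun x => ENNReal.ofReal (ρ x))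

/-- `g` is the gradient of weak partial derivatives of `f` in the open set `Ω`. -/
def HasWeakGradient {n : ℕ} (Ω : Set (EuclideanSpace ℝ (Fin n)))
    (f : EuclideanSpace ℝ (Fin n) → ℝ)
    (g : EuclideanSpace ℝ (Fin n) → EuclideanSpace ℝ (Fin n)) : Prop :=
  LocallyIntegrableOn f Ω volume ∧ LocallyIntegrableOn g Ω volume ∧
    ∀ φ : EuclideanSpace ℝ (Fin n) → ℝ, ContDiff ℝ ∞ φ → HasCompactSupport φ →
      tsupport φ ⊆ Ω → ∀ i : Fin n,
        ∫ x in Ω, f x * fderiv ℝ φ x (EuclideanSpace.single i 1) = - ∫ x in Ω, g x i * φ x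

/-- `μ` satisfies the classical Poincaré inequality on `Ω` with the finite constant `C > 0`:
`Var_μ(f) ≤ C ∫ ‖∇f‖² dμ` for all `f ∈ L²(μ)` whose weak gradient makes the right-hand side
finite. -/
def SatisfiesPoincare {n : ℕ} (Ω : Set (EuclideanSpace ℝ (Fin n)))
    (μ : Measure (EuclideanSpace ℝ (Fin n))) (C : ℝ) : Prop :=
  0 < C ∧ ∀ (f : EuclideanSpace ℝ (Fin n) → ℝ)
    (g : EuclideanSpace ℝ (Fin n) → EuclideanSpace ℝ (Fin n)),
    MemLp f 2 μ → HasWeakGradient Ω f g → Integrable (fun x => ‖g x‖ ^ 2) μ →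
      variance f μ ≤ C * ∫ x, ‖g x‖ ^ 2 ∂μ

/-- The optimal Poincaré constant `C_P(μ)`. -/
def poincareConstant {n : ℕ} (Ω : Set (EuclideanSpace ℝ (Fin n)))
    (μ : Measure (EuclideanSpace ℝ (Fin n))) : ℝ :=
  sInf {C : ℝ | SatisfiesPoincare Ω μ C}

/-- The `i`-th one-dimensional marginal of `μ`. -/
def marginal {n : ℕ} (μ : Measure (EuclideanSpace ℝ (Fin n))) (i : Fin n) : Measure ℝ :=
  μ.map (fun x => x i)

/-- `C` is the copula of `μ`: `F(x₁, …, xₙ) = C(F₁(x₁), …, Fₙ(xₙ))` for all real `x₁, …, xₙ`,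
where `F` is the joint cdf of `μ` and `F₁, …, Fₙ` are the cdfs of its marginals. -/
def HasCopula {n : ℕ} (μ : Measure (EuclideanSpace ℝ (Fin n))) (C : (Fin n → ℝ) → ℝ) : Prop :=
  ∀ x : Fin n → ℝ, μ.real {y | ∀ i, y i ≤ x i} = C (fun i => cdf (marginal μ i) (x i))

/-- The Gaussian copula with correlation matrix `A`: the joint cdf of `(Φ(Y₁), …, Φ(Yₙ))` for
`Y ∼ 𝓝(0, A)`, where `Φ` is the cdf of `𝓝(0, 1)`; equivalently
`u ↦ Φ_A(Φ⁻¹(u₁), …, Φ⁻¹(uₙ))` on `(0,1)ⁿ`, with `Φ_A` the joint cdf of `𝓝(0, A)`. -/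
def gaussianCopula {n : ℕ} (A : Matrix (Fin n) (Fin n) ℝ) (u : Fin n → ℝ) : ℝ :=
  (multivariateGaussian 0 A).real {y | ∀ i, cdf (gaussianReal 0 1) (y i) ≤ u i}

/-- Symmetric positive definite matrices with unit diagonal and off-diagonal entries
in `(-1, 1)`. -/
def IsCorrelationMatrix {n : ℕ} (A : Matrix (Fin n) (Fin n) ℝ) : Prop :=
  A.PosDef ∧ (∀ i, A i i = 1) ∧ ∀ i j, i ≠ j → A i j ∈ Set.Ioo (-1 : ℝ) 1

/-- The largest eigenvalue of a symmetric matrix. -/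
def lambdaMax {n : ℕ} (A : Matrix (Fin n) (Fin n) ℝ) : ℝ :=
  sSup (spectrum ℝ A)

/-- The measure `ν` on the line has a density `e^{-V}` on an open interval `I` (and no mass
outside `I`), with `V` twice differentiable and `V'' ≥ κ` on `I`. -/
def HasLogConcaveDensity (ν : Measure ℝ) (κ : ℝ) : Prop :=
  ∃ (I : Set ℝ) (V : ℝ → ℝ), IsOpen I ∧ I.OrdConnected ∧
    ν = (volume.restrict I).withDensity (fun x => ENNReal.ofReal (Real.exp (-V x))) ∧
    DifferentiableOn ℝ V I ∧ DifferentiableOn ℝ (deriv V) I ∧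
    ∀ x ∈ I, κ ≤ deriv (deriv V) x

end

/-! Let `T i` be the increasing map carrying the standard Gaussian on the line to the `i`-th
marginal. Since `T i y ≤ x` exactly when `Φ y ≤ F i x`, the copula hypothesis says that `μ` and the
image of `𝓝(0, A)` under the coordinatewise map `T` have the same joint cdf, hence are equal
(`eq_map_multivariateGaussian`). Writing `𝓝(0, A)` as the image of the standard Gaussian `γ` under
`√A` gives `Var_μ f = Var_γ (f ∘ T ∘ √A)`. The Gaussian Poincaré inequality bounds this by the
integral of `‖√A (DT ∇f)‖²`. Here `√A` costs at most `λ_max(A)`, and the diagonal matrix `DT` costs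
at most `max 1 / κ i`, because uniform log-concavity forces `(T i)' ≤ 1 / √κ i`. That contraction
(`sqrt_mul_gaussianPDFReal_le`) comes from a maximum principle.

The functions are only weakly differentiable, so two points need care. The Gaussian inequality is
proved by duality instead of approximation. With `L` minus the Ornstein–Uhlenbeck generator and
`e_t` the Wick exponentials, integration by parts gives `⟨h, L e_t⟩ = ⟨∇h, ∇e_t⟩`. Bochner's
identity `⟨L e_s, L e_t⟩ = ⟨∇e_s, ∇e_t⟩ + ⟨∇²e_s, ∇²e_t⟩` gives `‖∇u‖ ≤ ‖L u‖` on the span of the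
`e_t`. As the `L e_t` span a dense subspace of the centered functions, `‖h - E h‖ ≤ ‖∇h‖`
(`norm_le_of_gram_eq_add`, `variance_stdGaussian_le`).

Moreover, `Ω` must be the whole range of `T` (`eq_coordBox`): on a box with a slit removed, `f`
could jump across the slit at no cost in energy. The condition `interior (closure Ω) = Ω` excludes
this. -/

set_option linter.unusedSectionVars false

/-! ### Standard Gaussian measure and Wick exponentials. -/

section StdGaussian

open Real
open scoped RealInnerProductSpace

variable {V : Type*} [NormedAddCommGroup V] [InnerProductSpace ℝ V] [FiniteDimensional ℝ V]
  [MeasurableSpace V] [BorelSpace V]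

variable (V) in
/-- The normalizing constant of the standard Gaussian density. -/
noncomputable def gaussianNorm : ℝ := (2 * π) ^ (-(Module.finrank ℝ V / 2 : ℝ))

/-- The standard Gaussian density. -/
noncomputable def gaussianDensity (x : V) : ℝ := gaussianNorm V * exp (-‖x‖ ^ 2 / 2)

lemma gaussianDensity_pos (x : V) : 0 < gaussianDensity x :=
  mul_pos (by unfold gaussianNorm; positivity) (exp_pos _)

lemma continuous_gaussianDensity : Continuous (gaussianDensity (V := V)) := by
  unfold gaussianDensity; fun_prop

lemma integrable_exp_neg_sq : Integrable (fun x : V => exp (-‖x‖ ^ 2 / 2)) := by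
  have h := GaussianFourier.integrable_cexp_neg_mul_sq_norm_add (V := V) (b := 1 / 2)
    (by norm_num) 0 0
  refine h.norm.congr (.of_forall fun x => ?_)
  simp only [Complex.norm_exp]
  congr 1
  have : (-(1 / 2 : ℂ) * (‖x‖ : ℂ) ^ 2 + 0 * (inner ℝ (0 : V) x : ℝ)) =
    ((-‖x‖ ^ 2 / 2 : ℝ) : ℂ) := by push_cast; ring
  rw [this, Complex.ofReal_re]

/-- The characteristic functions agree. The density converts Gaussian integrals into Lebesgue
integrals, where translations and weak derivatives are available. -/
lemma stdGaussian_eq_withDensity :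
    stdGaussian V = volume.withDensity (fun x => ENNReal.ofReal (gaussianDensity x)) := by
  have hint : Integrable (fun x : V => gaussianDensity x) :=
    integrable_exp_neg_sq.const_mul _
  have : IsFiniteMeasure
      ((volume : Measure V).withDensity (fun x => ENNReal.ofReal (gaussianDensity x))) :=
    isFiniteMeasure_withDensity_ofReal hint.2
  apply Measure.ext_of_charFun
  ext t
  rw [charFun_stdGaussian, charFun_apply, integral_withDensity_eq_integral_toReal_smul
    (by have := continuous_gaussianDensity (V := V); fun_prop) (by simp)]
  have h := GaussianFourier.integral_cexp_neg_mul_sq_norm_add (V := V) (b := 1 / 2)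
    (by norm_num) Complex.I t
  have e : ∀ x : V, (ENNReal.ofReal (gaussianDensity x)).toReal •
      Complex.exp ((⟪x, t⟫ : ℝ) * Complex.I) = (gaussianNorm V : ℂ) *
      Complex.exp (-(1 / 2) * (‖x‖ : ℂ) ^ 2 + Complex.I * (⟪t, x⟫ : ℝ)) := by
    intro x
    rw [ENNReal.toReal_ofReal (gaussianDensity_pos x).le, gaussianDensity, Complex.real_smul,
      Complex.ofReal_mul, mul_assoc, Complex.ofReal_exp, ← Complex.exp_add, real_inner_comm]
    congr 2
    push_cast; ring
  simp_rw [e]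
  rw [integral_const_mul, h, ← mul_assoc]
  have h2 : (gaussianNorm V : ℂ) * ((π : ℂ) / (1 / 2)) ^ (Module.finrank ℝ V / 2 : ℂ) = 1 := by
    have : ((π : ℂ) / (1 / 2)) ^ (Module.finrank ℝ V / 2 : ℂ) =
        (((2 * π) ^ (Module.finrank ℝ V / 2 : ℝ) : ℝ) : ℂ) := by
      rw [Complex.ofReal_cpow (by positivity)]; push_cast; congr 1; ring
    rw [this, ← Complex.ofReal_mul, gaussianNorm, ← rpow_add (by positivity)]
    simp
  rw [h2, one_mul]
  congr 1
  simp; ring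

lemma integral_stdGaussian_eq {F : Type*} [NormedAddCommGroup F] [NormedSpace ℝ F] (f : V → F) :
    ∫ x, f x ∂(stdGaussian V) = ∫ x, gaussianDensity x • f x := by
  rw [stdGaussian_eq_withDensity, integral_withDensity_eq_integral_toReal_smul
    (by have := continuous_gaussianDensity (V := V); fun_prop) (by simp)]
  simp_rw [ENNReal.toReal_ofReal (gaussianDensity_pos _).le]

lemma integrable_stdGaussian_iff {F : Type*} [NormedAddCommGroup F] [NormedSpace ℝ F]
    (f : V → F) :
    Integrable f (stdGaussian V) ↔ Integrable (fun x => gaussianDensity x • f x) := by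
  rw [stdGaussian_eq_withDensity, integrable_withDensity_iff_integrable_smul'
    (by have := continuous_gaussianDensity (V := V); fun_prop) (by simp)]
  simp_rw [ENNReal.toReal_ofReal (gaussianDensity_pos _).le]

/-- The exponential martingale `exp (⟪t, x⟫ - ‖t‖² / 2)`. -/
noncomputable def wickExp (t x : V) : ℝ := exp (⟪t, x⟫ - ‖t‖ ^ 2 / 2)

lemma continuous_wickExp (t : V) : Continuous (wickExp t) := by
  unfold wickExp; fun_prop

lemma wickExp_pos (t x : V) : 0 < wickExp t x := exp_pos _

lemma wickExp_mul (s t x : V) :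
    wickExp s x * wickExp t x = exp ⟪s, t⟫ * wickExp (s + t) x := by
  simp only [wickExp, ← exp_add]
  congr 1
  rw [norm_add_sq_real, inner_add_left]; ring

/-- Completing the square. This is the Cameron–Martin shift: weighting by `wickExp t` amounts to
translating by `t`, so every integral below reduces to polynomial moments. -/
lemma gaussianDensity_mul_wickExp (t x : V) :
    gaussianDensity x * wickExp t x = gaussianDensity (x - t) := by
  simp only [wickExp, gaussianDensity, mul_assoc, ← exp_add]
  congr 2
  rw [norm_sub_sq_real, real_inner_comm]; ring

lemma integrable_wickExp_smul_iff {F : Type*} [NormedAddCommGroup F] [NormedSpace ℝ F]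
    (t : V) (f : V → F) :
    Integrable (fun x => wickExp t x • f x) (stdGaussian V) ↔
      Integrable (fun x => f (x + t)) (stdGaussian V) := by
  rw [integrable_stdGaussian_iff, integrable_stdGaussian_iff]
  simp_rw [smul_smul, gaussianDensity_mul_wickExp]
  rw [← (measurePreserving_add_right volume t).integrable_comp_emb
    (MeasurableEquiv.addRight t).measurableEmbedding]
  simp [Function.comp_def]

lemma integral_wickExp_smul {F : Type*} [NormedAddCommGroup F] [NormedSpace ℝ F]
    (t : V) (f : V → F) :
    ∫ x, wickExp t x • f x ∂(stdGaussian V) = ∫ x, f (x + t) ∂(stdGaussian V) := by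
  rw [integral_stdGaussian_eq, integral_stdGaussian_eq]
  simp_rw [smul_smul, gaussianDensity_mul_wickExp]
  rw [← integral_add_right_eq_self (fun x => gaussianDensity (x - t) • f x) t]
  simp

lemma memLp_inner_stdGaussian (s : V) (c : ℝ) :
    MemLp (fun x => ⟪s, x⟫ + c) 2 (stdGaussian V) :=
  ((innerSL ℝ s).comp_memLp' IsGaussian.memLp_two_id).add (memLp_const c)

lemma memLp_inner_mul_wickExp (s : V) (c : ℝ) (t : V) :
    MemLp (fun x => (⟪s, x⟫ + c) * wickExp t x) 2 (stdGaussian V) := by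
  have hc := continuous_wickExp t
  rw [memLp_two_iff_integrable_sq (by fun_prop)]
  have : (fun x => ((⟪s, x⟫ + c) * wickExp t x) ^ 2) =
      fun x => exp ⟪t, t⟫ * (wickExp (t + t) x • (⟪s, x⟫ + c) ^ 2) := by
    ext x
    rw [mul_pow, pow_two (wickExp t x), wickExp_mul]; simp; ring
  rw [this]
  refine Integrable.const_mul ?_ _
  rw [integrable_wickExp_smul_iff]
  have := memLp_inner_stdGaussian s (⟪s, t + t⟫ + c)
  refine this.integrable_sq.congr (.of_forall fun x => ?_)
  simp [inner_add_right]; ring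

lemma memLp_wickExp (t : V) : MemLp (wickExp t) 2 (stdGaussian V) := by
  simpa using memLp_inner_mul_wickExp 0 1 t

lemma memLp_wickExp_smul {F : Type*} [NormedAddCommGroup F] [NormedSpace ℝ F] (t : V) (a : F) :
    MemLp (fun x => wickExp t x • a) 2 (stdGaussian V) :=
  ((ContinuousLinearMap.toSpanSingleton ℝ a).comp_memLp' (memLp_wickExp t))

lemma integral_wickExp_mul (s t : V) :
    ∫ x, wickExp s x * wickExp t x ∂(stdGaussian V) = exp ⟪s, t⟫ := by
  simp_rw [wickExp_mul]
  rw [integral_const_mul]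
  have := integral_wickExp_smul (s + t) (fun _ : V => (1 : ℝ))
  simp at this
  rw [this, mul_one]

lemma integral_inner_stdGaussian (s : V) : ∫ x, ⟪s, x⟫ ∂(stdGaussian V) = 0 := by
  simpa using integral_strongDual_stdGaussian (innerSL ℝ s)

lemma integral_inner_mul_inner_stdGaussian (s t : V) :
    ∫ x, ⟪s, x⟫ * ⟪t, x⟫ ∂(stdGaussian V) = ⟪s, t⟫ := by
  have h := covarianceBilin_apply_eq_cov (μ := stdGaussian V) IsGaussian.memLp_two_id s t
  rw [covarianceBilin_stdGaussian, innerSL_apply_apply] at h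
  rw [h, covariance_eq_sub, integral_inner_stdGaussian, integral_inner_stdGaussian]
  · simp
  · simpa using memLp_inner_stdGaussian s 0
  · simpa using memLp_inner_stdGaussian t 0

/-- Minus the Ornstein–Uhlenbeck generator applied to `wickExp t`. -/
noncomputable def wickGen (t x : V) : ℝ := (⟪t, x⟫ - ‖t‖ ^ 2) * wickExp t x

lemma memLp_wickGen (t : V) : MemLp (wickGen t) 2 (stdGaussian V) := by
  have := memLp_inner_mul_wickExp t (-‖t‖ ^ 2) t
  simp only [← sub_eq_add_neg] at this
  exact this

lemma integral_wickGen (t : V) : ∫ x, wickGen t x ∂(stdGaussian V) = 0 := by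
  have := integral_wickExp_smul t (fun x : V => ⟪t, x⟫ - ‖t‖ ^ 2)
  simp only [smul_eq_mul, mul_comm (wickExp t _)] at this
  simp only [wickGen]
  rw [this]
  simp [inner_add_right, integral_inner_stdGaussian]

/-- The exponentials merge into `wickExp (s + t)`; the shift by `s + t` leaves affine factors whose
covariance is `⟪s, t⟫`. In the result, the first power of `⟪s, t⟫` is the gradient term of Bochner's
identity and the square is the Hessian term. -/
lemma integral_wickGen_mul (s t : V) :
    ∫ x, wickGen s x * wickGen t x ∂(stdGaussian V) = (⟪s, t⟫ + ⟪s, t⟫ ^ 2) * exp ⟪s, t⟫ := by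
  have e : ∀ x : V, wickGen s x * wickGen t x =
      exp ⟪s, t⟫ * (wickExp (s + t) x • ((⟪s, x⟫ - ‖s‖ ^ 2) * (⟪t, x⟫ - ‖t‖ ^ 2))) := by
    intro x
    have := wickExp_mul s t x
    simp only [wickGen, smul_eq_mul]
    linear_combination (⟪s, x⟫ - ‖s‖ ^ 2) * (⟪t, x⟫ - ‖t‖ ^ 2) * this
  simp_rw [e]
  rw [integral_const_mul, integral_wickExp_smul, mul_comm]
  congr 1
  have e2 : ∀ x : V, (⟪s, x + (s + t)⟫ - ‖s‖ ^ 2) * (⟪t, x + (s + t)⟫ - ‖t‖ ^ 2) =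
      ⟪s, x⟫ * ⟪t, x⟫ + (⟪s, t⟫ * ⟪s, x⟫ + ⟪s, t⟫ * ⟪t, x⟫ + ⟪s, t⟫ ^ 2) := by
    intro x
    simp only [inner_add_right, real_inner_self_eq_norm_sq, real_inner_comm s t]
    ring
  simp_rw [e2]
  have hs : MemLp (fun x => ⟪s, x⟫) 2 (stdGaussian V) := by
    simpa using memLp_inner_stdGaussian s 0
  have ht : MemLp (fun x => ⟪t, x⟫) 2 (stdGaussian V) := by
    simpa using memLp_inner_stdGaussian t 0
  have hs1 := (hs.integrable (by norm_num)).const_mul ⟪s, t⟫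
  have ht1 := (ht.integrable (by norm_num)).const_mul ⟪s, t⟫
  rw [integral_add (f := fun x => ⟪s, x⟫ * ⟪t, x⟫)
      (g := fun x => ⟪s, t⟫ * ⟪s, x⟫ + ⟪s, t⟫ * ⟪t, x⟫ + ⟪s, t⟫ ^ 2)
      (hs.integrable_mul ht) ((hs1.add ht1).add (integrable_const _)),
    integral_add (f := fun x => ⟪s, t⟫ * ⟪s, x⟫ + ⟪s, t⟫ * ⟪t, x⟫) (hs1.add ht1)
      (integrable_const _), integral_add hs1 ht1, integral_const_mul, integral_const_mul,
    integral_inner_mul_inner_stdGaussian, integral_inner_stdGaussian, integral_inner_stdGaussian]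
  simp

end StdGaussian

/-! ### Abstract duality in Hilbert space. -/

section Duality

open scoped RealInnerProductSpace

/-- If the Gram kernel of `q` dominates that of `r`, a vector in the closed span of `q` whose
pairings with `q` are those of `g` with `r` has norm at most `‖g‖`. -/
lemma norm_le_of_gram_eq_add {ι H H₁ H₂ : Type*}
    [NormedAddCommGroup H] [InnerProductSpace ℝ H] [NormedAddCommGroup H₁]
    [InnerProductSpace ℝ H₁] [NormedAddCommGroup H₂] [InnerProductSpace ℝ H₂]
    (q : ι → H) (r : ι → H₁) (m : ι → H₂)
    (h : ∀ s t, ⟪q s, q t⟫ = ⟪r s, r t⟫ + ⟪m s, m t⟫) (f : H) (g : H₁)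
    (hf : f ∈ closure (Submodule.span ℝ (Set.range q) : Set H))
    (hfg : ∀ t, ⟪f, q t⟫ = ⟪g, r t⟫) : ‖f‖ ≤ ‖g‖ := by
  have gram : ∀ c : ι →₀ ℝ, ‖Finsupp.linearCombination ℝ r c‖ ≤
      ‖Finsupp.linearCombination ℝ q c‖ := by
    intro c
    have : ‖Finsupp.linearCombination ℝ q c‖ ^ 2 = ‖Finsupp.linearCombination ℝ r c‖ ^ 2 +
        ‖Finsupp.linearCombination ℝ m c‖ ^ 2 := by
      simp only [← real_inner_self_eq_norm_sq, Finsupp.linearCombination_apply, Finsupp.sum,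
        sum_inner, inner_sum, real_inner_smul_left, real_inner_smul_right, h,
        ← Finset.sum_add_distrib]
      refine Finset.sum_congr rfl fun i _ => Finset.sum_congr rfl fun j _ => by ring
    refine le_of_sq_le_sq ?_ (norm_nonneg _)
    nlinarith [sq_nonneg ‖Finsupp.linearCombination ℝ m c‖]
  have pair : ∀ c : ι →₀ ℝ, ⟪f, Finsupp.linearCombination ℝ q c⟫ =
      ⟪g, Finsupp.linearCombination ℝ r c⟫ := by
    intro c
    simp only [Finsupp.linearCombination_apply, Finsupp.sum, inner_sum, real_inner_smul_right, hfg]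
  have bound : ∀ u ∈ (Submodule.span ℝ (Set.range q) : Set H), ⟪f, u⟫ ≤ ‖g‖ * ‖u‖ := by
    intro u hu
    rw [← Finsupp.range_linearCombination] at hu
    obtain ⟨c, rfl⟩ := hu
    rw [pair]
    exact (real_inner_le_norm _ _).trans (mul_le_mul_of_nonneg_left (gram c) (norm_nonneg _))
  -- The bound is a closed condition on `u`, so it extends from the span to `u = f`.
  have key : ⟪f, f⟫ ≤ ‖g‖ * ‖f‖ := by
    have hcl : IsClosed {u : H | ⟪f, u⟫ ≤ ‖g‖ * ‖u‖} :=
      isClosed_le (by fun_prop) (by fun_prop)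
    exact closure_minimal bound hcl hf
  rw [real_inner_self_eq_norm_sq] at key
  by_contra hlt
  push Not at hlt
  nlinarith [norm_nonneg g, norm_nonneg f]

end Duality

/-! ### Gaussian Poincaré inequality for weakly differentiable functions. -/

section GaussianPoincare

open Real Filter Topology
open scoped RealInnerProductSpace

variable {V : Type*} [NormedAddCommGroup V] [InnerProductSpace ℝ V] [FiniteDimensional ℝ V]
  [MeasurableSpace V] [BorelSpace V]

/-- `G` is a weak gradient of `h` on the whole space, tested against compactly supported `C¹`
functions. -/
def IsWeakGradientC1 (h : V → ℝ) (G : V → V) : Prop :=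
  ∀ φ : V → ℝ, ContDiff ℝ 1 φ → HasCompactSupport φ → ∀ w : V,
    ∫ x, h x * fderiv ℝ φ x w = -∫ x, ⟪G x, w⟫ * φ x

lemma hasFDerivAt_gaussianDensity_sub (t x : V) :
    HasFDerivAt (fun x => gaussianDensity (x - t))
      ((-gaussianDensity (x - t)) • innerSL ℝ (x - t)) x := by
  have h1 : HasFDerivAt (fun x : V => -‖x - t‖ ^ 2 / 2) (-innerSL ℝ (x - t)) x := by
    have := (((hasFDerivAt_id x).sub_const t).norm_sq).const_mul (-1 / 2 : ℝ)
    convert! this using 1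
    · ext y; simp; ring
    · ext y; simp; ring
  have h2 := (h1.exp).const_mul (gaussianNorm V)
  convert! h2 using 1
  ext y
  simp [gaussianDensity]; ring

lemma contDiff_gaussianDensity_sub (t : V) {k : WithTop ℕ∞} :
    ContDiff ℝ k (fun x : V => gaussianDensity (x - t)) := by
  unfold gaussianDensity
  exact contDiff_const.mul
    ((((contDiff_id.sub contDiff_const).norm_sq ℝ).neg.div_const 2).exp)

lemma MemLp.integrable_fun_mul {α : Type*} {m : MeasurableSpace α} {μ : Measure α} {f g : α → ℝ}
    (hf : MemLp f 2 μ) (hg : MemLp g 2 μ) : Integrable (fun x => f x * g x) μ :=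
  MemLp.integrable_mul hf hg

/-- Gaussian integration by parts of a weakly differentiable function against Wick
exponentials. -/
lemma integral_mul_wickGen_eq {h : V → ℝ} {G : V → V} (hw : IsWeakGradientC1 h G)
    (hh : MemLp h 2 (stdGaussian V)) (hG : MemLp G 2 (stdGaussian V)) (t : V) :
    ∫ x, h x * wickGen t x ∂(stdGaussian V) = ∫ x, ⟪G x, t⟫ * wickExp t x ∂(stdGaussian V) := by
  -- The natural test function, the density times `wickExp t`, lacks compact support. It is cut off
  -- by `χ (r k • x)` with `r k = 1 / (k + 1)`: the cutoff tends to 1 and its derivative carries a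
  -- factor `r k`.
  let χ : ContDiffBump (0 : V) := ⟨1, 2, one_pos, one_lt_two⟩
  have hχ : ContDiff ℝ 1 (χ : V → ℝ) := χ.contDiff
  let r : ℕ → ℝ := fun k => ((k : ℝ) + 1)⁻¹
  have hr0 : ∀ k, 0 < r k := fun k => by positivity
  have hr1 : ∀ k, r k ≤ 1 := fun k => inv_le_one_of_one_le₀ (by simp)
  have hr : Tendsto r atTop (𝓝 0) := by
    simpa [r] using tendsto_one_div_add_atTop_nhds_zero_nat (𝕜 := ℝ)
  have hfd : Continuous fun x => fderiv ℝ χ x t :=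
    (hχ.continuous_fderiv one_ne_zero).clm_apply continuous_const
  obtain ⟨C, hC⟩ := (χ.hasCompactSupport.fderiv_apply (𝕜 := ℝ) t).exists_bound_of_continuous hfd
  have hscale : ∀ k x, HasFDerivAt (fun x : V => χ (r k • x)) (r k • fderiv ℝ χ (r k • x)) x := by
    intro k x
    have h1 := ((hχ.differentiable one_ne_zero) (r k • x)).hasFDerivAt
    have h2 : HasFDerivAt (fun x : V => r k • x) (r k • ContinuousLinearMap.id ℝ V) x :=
      (hasFDerivAt_id x).const_smul (r k)
    convert! h1.comp x h2 using 1
    ext y; simp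
  have hid : ∀ k : ℕ, ∫ x, h x * (-(χ (r k • x) * wickGen t x) +
      r k * (fderiv ℝ χ (r k • x) t * wickExp t x)) ∂(stdGaussian V) =
      -∫ x, χ (r k • x) * (⟪G x, t⟫ * wickExp t x) ∂(stdGaussian V) := by
    intro k
    -- The derivative of the shifted density along `t` is minus the density times `wickGen t`.
    have h1 := hw (fun x => χ (r k • x) * gaussianDensity (x - t))
      ((hχ.comp (contDiff_const_smul (r k))).mul (contDiff_gaussianDensity_sub t))
      ((χ.hasCompactSupport.comp_smul (hr0 k).ne').mul_right) t
    rw [integral_stdGaussian_eq, integral_stdGaussian_eq]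
    convert! h1 using 1
    · refine integral_congr_ae (.of_forall fun x => ?_)
      have h2 := ((hscale k x).mul (hasFDerivAt_gaussianDensity_sub t x)).fderiv
      change _ = h x * fderiv ℝ ((fun x => χ (r k • x)) * fun x => gaussianDensity (x - t)) x t
      rw [h2]
      simp only [← gaussianDensity_mul_wickExp, smul_eq_mul, wickGen,
        add_apply, smul_apply, innerSL_apply_apply,
        inner_sub_left, real_inner_self_eq_norm_sq, real_inner_comm t x]
      ring
    · congr 1
      refine integral_congr_ae (.of_forall fun x => ?_)
      simp only [← gaussianDensity_mul_wickExp, smul_eq_mul]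
      ring
  have hGt : MemLp (fun x => ⟪G x, t⟫) 2 (stdGaussian V) := by
    refine ((innerSL ℝ t).comp_memLp' hG).congr_norm (by
      have := hG.aestronglyMeasurable; fun_prop) (.of_forall fun x => ?_)
    simp [real_inner_comm t]
  have i1 : Integrable (fun x => h x * wickGen t x) (stdGaussian V) :=
    hh.integrable_mul (memLp_wickGen t)
  have i2 : Integrable (fun x => h x * wickExp t x) (stdGaussian V) :=
    hh.integrable_mul (memLp_wickExp t)
  have i3 : Integrable (fun x => ⟪G x, t⟫ * wickExp t x) (stdGaussian V) :=
    hGt.integrable_mul (memLp_wickExp t)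
  have hχ1 : ∀ x : V, Tendsto (fun k => χ (r k • x)) atTop (𝓝 1) := by
    intro x
    have h0 : Tendsto (fun k => r k • x) atTop (𝓝 0) := by
      simpa using hr.smul_const x
    have h3 := (hχ.continuous.tendsto 0).comp h0
    rwa [χ.one_of_mem_closedBall (by simp [χ])] at h3
  have hcχ : Continuous (χ : V → ℝ) := hχ.continuous
  have hcg : Continuous (wickExp t) := continuous_wickExp t
  have hcG : Continuous (wickGen t) := by unfold wickGen; fun_prop
  have hcd : Continuous (fun x => fderiv ℝ χ x t) := hfd
  have lim1 : Tendsto (fun k : ℕ => ∫ x, h x * (-(χ (r k • x) * wickGen t x) +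
      r k * (fderiv ℝ χ (r k • x) t * wickExp t x)) ∂(stdGaussian V)) atTop
      (𝓝 (∫ x, -(h x * wickGen t x) ∂(stdGaussian V))) := by
    refine tendsto_integral_of_dominated_convergence
      (fun x => ‖h x * wickGen t x‖ + C * ‖h x * wickExp t x‖) ?_
      (i1.norm.add (i2.norm.const_mul C)) ?_ ?_
    · intro k
      have hm : Continuous fun x => -(χ (r k • x) * wickGen t x) +
          r k * (fderiv ℝ χ (r k • x) t * wickExp t x) := by
        have := hcd.comp (continuous_const_smul (r k))
        simp only [Function.comp_def] at this
        fun_prop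
      exact hh.aestronglyMeasurable.mul hm.aestronglyMeasurable
    · intro k
      refine .of_forall fun x => ?_
      rw [mul_add]
      refine (norm_add_le _ _).trans (add_le_add ?_ ?_)
      · simp only [norm_mul, norm_neg]
        refine mul_le_mul_of_nonneg_left ?_ (norm_nonneg _)
        refine mul_le_of_le_one_left (norm_nonneg _) ?_
        rw [Real.norm_eq_abs, abs_of_nonneg χ.nonneg]
        exact χ.le_one
      · simp only [norm_mul]
        have h5 := hC (r k • x)
        have h6 : ‖r k‖ ≤ 1 := by rw [Real.norm_eq_abs, abs_of_pos (hr0 k)]; exact hr1 k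
        calc ‖h x‖ * (‖r k‖ * (‖fderiv ℝ χ (r k • x) t‖ * ‖wickExp t x‖))
            ≤ ‖h x‖ * (1 * (C * ‖wickExp t x‖)) := by gcongr
          _ = C * (‖h x‖ * ‖wickExp t x‖) := by ring
    · refine .of_forall fun x => ?_
      have l1 : Tendsto (fun k => χ (r k • x) * wickGen t x) atTop (𝓝 (1 * wickGen t x)) :=
        (hχ1 x).mul_const _
      have l2 : Tendsto (fun k => r k * (fderiv ℝ χ (r k • x) t * wickExp t x)) atTop (𝓝 0) := by
        refine squeeze_zero_norm (a := fun k => r k * (C * wickExp t x)) (fun k => ?_)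
          (by simpa using hr.mul_const (C * wickExp t x))
        simp only [norm_mul, Real.norm_eq_abs (r k), abs_of_pos (hr0 k),
          Real.norm_eq_abs (wickExp t x), abs_of_pos (wickExp_pos t x)]
        have := hC (r k • x)
        have := hr0 k
        have := wickExp_pos t x
        gcongr
      have := (l1.neg.add l2).const_mul (h x)
      simpa using this
  have lim2 : Tendsto (fun k : ℕ => -∫ x, χ (r k • x) * (⟪G x, t⟫ * wickExp t x)
      ∂(stdGaussian V)) atTop (𝓝 (-∫ x, ⟪G x, t⟫ * wickExp t x ∂(stdGaussian V))) := by
    refine (tendsto_integral_of_dominated_convergence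
      (fun x => ‖⟪G x, t⟫ * wickExp t x‖) ?_ i3.norm ?_ ?_).neg
    · intro k
      have hm : Continuous fun x : V => χ (r k • x) := by fun_prop
      exact hm.aestronglyMeasurable.mul i3.aestronglyMeasurable
    · intro k
      refine .of_forall fun x => ?_
      rw [norm_mul]
      refine mul_le_of_le_one_left (norm_nonneg _) ?_
      rw [Real.norm_eq_abs, abs_of_nonneg χ.nonneg]
      exact χ.le_one
    · refine .of_forall fun x => ?_
      simpa using (hχ1 x).mul_const (⟪G x, t⟫ * wickExp t x)
  simp_rw [hid] at lim1
  have := tendsto_nhds_unique lim1 lim2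
  rw [integral_neg] at this
  linarith

/-- Finite measures with the same (everywhere finite) moment generating functions in all
directions are equal. -/
lemma Measure.ext_of_mgf_inner {ν₁ ν₂ : Measure V} [IsFiniteMeasure ν₁] [IsFiniteMeasure ν₂]
    (hint : ∀ t : V, Integrable (fun x => exp ⟪t, x⟫) ν₁)
    (heq : ∀ t : V, ∫ x, exp ⟪t, x⟫ ∂ν₁ = ∫ x, exp ⟪t, x⟫ ∂ν₂) : ν₁ = ν₂ := by
  apply Measure.ext_of_charFun
  ext t
  have hset : integrableExpSet (fun x : V => ⟪t, x⟫) ν₁ = Set.univ := by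
    ext s
    simp only [integrableExpSet, Set.mem_ofPred_eq, Set.mem_univ, iff_true]
    simpa [inner_smul_left] using hint (s • t)
  have hmgf : mgf (fun x : V => ⟪t, x⟫) ν₁ = mgf (fun x : V => ⟪t, x⟫) ν₂ := by
    ext s
    simpa [mgf, inner_smul_left] using heq (s • t)
  have hzero : ν₁ = 0 ↔ ν₂ = 0 := by
    have := heq 0
    simp only [inner_zero_left, exp_zero, integral_const, smul_eq_mul, mul_one] at this
    rw [← Measure.measure_univ_eq_zero, ← Measure.measure_univ_eq_zero,
      ← measureReal_eq_zero_iff, ← measureReal_eq_zero_iff, this]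
  -- Analytic continuation along the direction `t`: the complex moment generating function at `I` is
  -- the characteristic function at `t`.
  have := eqOn_complexMGF_of_mgf' hmgf hzero (x := Complex.I) (by simp [hset])
  simp only [complexMGF] at this
  rw [charFun_apply, charFun_apply]
  simpa [real_inner_comm, mul_comm] using this

lemma memLp_exp_inner (t : V) : MemLp (fun x => exp ⟪t, x⟫) 2 (stdGaussian V) := by
  have := (memLp_wickExp t).const_mul (exp (‖t‖ ^ 2 / 2))
  refine this.ae_eq (.of_forall fun x => ?_)
  simp only [wickExp, ← exp_add]
  congr 1; ring

/-- A square integrable function orthogonal to `1` and to all `wickGen t` vanishes. -/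
lemma ae_eq_zero_of_integral_wickGen {k : V → ℝ} (hk : MemLp k 2 (stdGaussian V))
    (h1 : ∫ x, k x ∂(stdGaussian V) = 0)
    (hq : ∀ t, ∫ x, k x * wickGen t x ∂(stdGaussian V) = 0) : k =ᵐ[stdGaussian V] 0 := by
  have hki := hk.integrable (by norm_num : (1 : ENNReal) ≤ 2)
  have main : ∀ t : V, ∫ x, k x * exp ⟪t, x⟫ ∂(stdGaussian V) = 0 := by
    intro t
    -- `N s` is the pairing of `k` with `wickExp (s • t)`. For `s ≠ 0` its derivative is `1 / s`
    -- times the pairing with `wickGen (s • t)`, hence zero; `N` is continuous and `N 0 = ∫ k = 0`,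
    -- so `N 1 = 0`.
    let N : ℝ → ℝ := fun s => exp (-(s ^ 2 * ‖t‖ ^ 2 / 2)) *
      ∫ x, k x * exp (s * ⟪t, x⟫) ∂(stdGaussian V)
    have hder : ∀ s : ℝ, HasDerivAt (fun s => ∫ x, k x * exp (s * ⟪t, x⟫) ∂(stdGaussian V))
        (∫ x, k x * (⟪t, x⟫ * exp (s * ⟪t, x⟫)) ∂(stdGaussian V)) s := by
      intro s
      -- For `|u - s| < 1`, the factor `|y| ≤ exp |y|` and the change from `s` to `u` each cost at
      -- most one unit in the exponent, whence `s ± 2` according to the sign of `y`.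
      have hb : MemLp (fun x => exp ⟪(s + 2) • t, x⟫ + exp ⟪(s - 2) • t, x⟫) 2 (stdGaussian V) :=
        (memLp_exp_inner _).add (memLp_exp_inner _)
      have hc : ∀ s : ℝ, AEStronglyMeasurable (fun x : V => k x * exp (s * ⟪t, x⟫))
          (stdGaussian V) := fun s =>
        hk.aestronglyMeasurable.mul (by fun_prop : Continuous _).aestronglyMeasurable
      refine (hasDerivAt_integral_of_dominated_loc_of_deriv_le (F := fun s x =>
        k x * exp (s * ⟪t, x⟫)) (F' := fun s x => k x * (⟪t, x⟫ * exp (s * ⟪t, x⟫)))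
        (bound := fun x => ‖k x‖ * (exp ⟪(s + 2) • t, x⟫ + exp ⟪(s - 2) • t, x⟫))
        (Metric.ball_mem_nhds s one_pos) (.of_forall hc) ?_ ?_ ?_ ?_ ?_).2
      · have := hk.integrable_mul (memLp_exp_inner (s • t))
        simpa [inner_smul_left, Pi.mul_def] using this
      · exact hk.aestronglyMeasurable.mul (by fun_prop : Continuous _).aestronglyMeasurable
      · refine .of_forall fun x u hu => ?_
        rw [Metric.mem_ball, Real.dist_eq, abs_lt] at hu
        rw [norm_mul]
        refine mul_le_mul_of_nonneg_left ?_ (norm_nonneg _)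
        simp only [inner_smul_left, conj_trivial]
        set y := ⟪t, x⟫
        rw [norm_mul, Real.norm_eq_abs, Real.norm_eq_abs, abs_of_pos (exp_pos _)]
        have hy : |y| ≤ exp |y| := by linarith [add_one_le_exp |y|]
        have e1 : |y| * exp (u * y) ≤ exp (|y| + u * y) := by
          rw [exp_add]; gcongr
        refine e1.trans ?_
        rcases le_total 0 y with h0 | h0
        · rw [abs_of_nonneg h0]
          have : exp (y + u * y) ≤ exp ((s + 2) * y) := exp_le_exp.2 (by nlinarith)
          linarith [exp_pos ((s - 2) * y)]
        · rw [abs_of_nonpos h0]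
          have : exp (-y + u * y) ≤ exp ((s - 2) * y) := exp_le_exp.2 (by nlinarith)
          linarith [exp_pos ((s + 2) * y)]
      · exact hk.norm.integrable_mul hb
      · refine .of_forall fun x u _ => ?_
        have := (((hasDerivAt_id u).mul_const ⟪t, x⟫).exp).const_mul (k x)
        convert! this using 1
        simp only [id, one_mul]; ring
    have hN : ∀ s : ℝ, s ≠ 0 → HasDerivAt N 0 s := by
      intro s hs
      have hE : HasDerivAt (fun s : ℝ => exp (-(s ^ 2 * ‖t‖ ^ 2 / 2)))
          (exp (-(s ^ 2 * ‖t‖ ^ 2 / 2)) * (-(s * ‖t‖ ^ 2))) s := by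
        have := ((((hasDerivAt_pow 2 s).mul_const (‖t‖ ^ 2)).div_const 2).neg).exp
        convert! this using 1
        simp; ring
      have := hE.mul (hder s)
      convert! this using 1
      have h2 := hq (s • t)
      have e : ∀ x : V, k x * wickGen (s • t) x = exp (-(s ^ 2 * ‖t‖ ^ 2 / 2)) *
          (s * (k x * (⟪t, x⟫ * exp (s * ⟪t, x⟫))) -
            s ^ 2 * ‖t‖ ^ 2 * (k x * exp (s * ⟪t, x⟫))) := by
        intro x
        simp only [wickGen, wickExp, inner_smul_left, conj_trivial, norm_smul, mul_pow,
          Real.norm_eq_abs, sq_abs, sub_eq_add_neg, exp_add]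
        ring
      simp_rw [e] at h2
      have i1 : Integrable (fun x => k x * exp (s * ⟪t, x⟫)) (stdGaussian V) := by
        have := hk.integrable_mul (memLp_exp_inner (s • t))
        simpa [inner_smul_left, Pi.mul_def] using this
      have i2 : Integrable (fun x => k x * (⟪t, x⟫ * exp (s * ⟪t, x⟫))) (stdGaussian V) := by
        have h3 := (memLp_inner_mul_wickExp t 0 (s • t)).const_mul (exp (‖s • t‖ ^ 2 / 2))
        refine (hk.integrable_mul h3).congr (.of_forall fun x => ?_)
        simp only [Pi.mul_apply, add_zero, wickExp, sub_eq_add_neg, exp_add, inner_smul_left,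
          conj_trivial]
        have : exp (‖s • t‖ ^ 2 / 2) * exp (-(‖s • t‖ ^ 2 / 2)) = 1 := by
          rw [← exp_add]; simp
        linear_combination k x * ⟪t, x⟫ * exp (s * ⟪t, x⟫) * this
      rw [integral_const_mul, integral_sub (i2.const_mul _) (i1.const_mul _), integral_const_mul,
        integral_const_mul] at h2
      have h3 := (mul_eq_zero.1 h2).resolve_left (exp_pos _).ne'
      have h4 : s * (∫ x, k x * (⟪t, x⟫ * exp (s * ⟪t, x⟫)) ∂(stdGaussian V) -
          s * ‖t‖ ^ 2 * ∫ x, k x * exp (s * ⟪t, x⟫) ∂(stdGaussian V)) = 0 := by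
        rw [← h3]; ring
      have h5 := (mul_eq_zero.1 h4).resolve_left hs
      linear_combination (-exp (-(s ^ 2 * ‖t‖ ^ 2 / 2))) * h5
    have hNc : Continuous N := by
      have : Continuous (fun s => ∫ x, k x * exp (s * ⟪t, x⟫) ∂(stdGaussian V)) :=
        continuous_iff_continuousAt.2 fun s => (hder s).continuousAt
      fun_prop
    obtain ⟨c, hc, hc'⟩ := exists_hasDerivAt_eq_slope N (fun _ => 0) one_pos hNc.continuousOn
      (fun s hs => hN s hs.1.ne')
    have h01 : N 1 = N 0 := by
      simp only [sub_zero, div_one] at hc'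
      linarith
    simp only [N] at h01
    simp only [one_pow, one_mul, zero_mul, exp_zero, mul_one, h1, mul_zero] at h01
    exact (mul_eq_zero.1 h01).resolve_left (exp_pos _).ne'
  -- The Laplace transform of `k` vanishes, so the positive and negative parts of `k` are densities
  -- of two finite measures with equal Laplace transforms. These measures coincide, which forces `k
  -- = 0` almost everywhere.
  have hkp : Integrable (fun x => max (k x) 0) (stdGaussian V) := hki.pos_part
  have hkn : Integrable (fun x => max (-k x) 0) (stdGaussian V) := hki.neg_part
  have hdens : ∀ u : V → ℝ, MemLp u 2 (stdGaussian V) → 0 ≤ u → ∀ t : V,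
      Integrable (fun x => exp ⟪t, x⟫) ((stdGaussian V).withDensity fun x => ENNReal.ofReal (u x)) ∧
      ∫ x, exp ⟪t, x⟫ ∂((stdGaussian V).withDensity fun x => ENNReal.ofReal (u x)) =
        ∫ x, u x * exp ⟪t, x⟫ ∂(stdGaussian V) := by
    intro u hu hu0 t
    have hm : AEMeasurable (fun x => ENNReal.ofReal (u x)) (stdGaussian V) :=
      hu.aestronglyMeasurable.aemeasurable.ennreal_ofReal
    constructor
    · rw [integrable_withDensity_iff_integrable_smul₀' hm (by simp)]
      simp_rw [ENNReal.toReal_ofReal (hu0 _)]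
      exact hu.integrable_mul (memLp_exp_inner t)
    · rw [integral_withDensity_eq_integral_toReal_smul₀ hm (by simp)]
      simp_rw [ENNReal.toReal_ofReal (hu0 _), smul_eq_mul]
  have hP : MemLp (fun x => max (k x) 0) 2 (stdGaussian V) := hk.pos_part
  have hM : MemLp (fun x => max (-k x) 0) 2 (stdGaussian V) := hk.neg_part
  have := isFiniteMeasure_withDensity_ofReal hkp.2
  have := isFiniteMeasure_withDensity_ofReal hkn.2
  have heq : (stdGaussian V).withDensity (fun x => ENNReal.ofReal (max (k x) 0)) =
      (stdGaussian V).withDensity (fun x => ENNReal.ofReal (max (-k x) 0)) := by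
    refine Measure.ext_of_mgf_inner (fun t => (hdens _ hP (fun x => le_max_right _ _) t).1)
      fun t => ?_
    rw [(hdens _ hP (fun x => le_max_right _ _) t).2, (hdens _ hM (fun x => le_max_right _ _) t).2,
      ← sub_eq_zero, ← integral_sub (MemLp.integrable_fun_mul hP (memLp_exp_inner t))
        (MemLp.integrable_fun_mul hM (memLp_exp_inner t))]
    refine Eq.trans (integral_congr_ae (.of_forall fun x => ?_)) (main t)
    rcases le_total 0 (k x) with h | h
    · simp [h]
    · simp [h]
  rw [withDensity_eq_iff hkp.aestronglyMeasurable.aemeasurable.ennreal_ofReal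
    hkn.aestronglyMeasurable.aemeasurable.ennreal_ofReal (by
      have := hkp.lintegral_lt_top; exact this.ne)] at heq
  filter_upwards [heq] with x hx
  rw [ENNReal.ofReal_eq_ofReal_iff (le_max_right _ _) (le_max_right _ _)] at hx
  rcases le_total 0 (k x) with h | h
  · simpa [h] using hx
  · simpa [h] using hx.symm

lemma inner_toLp_wickExp_smul {F : Type*} [NormedAddCommGroup F] [InnerProductSpace ℝ F]
    (s t : V) (a b : F) :
    ⟪(memLp_wickExp_smul s a).toLp, (memLp_wickExp_smul t b).toLp⟫ = ⟪a, b⟫ * exp ⟪s, t⟫ := by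
  rw [L2.inner_def, ← integral_wickExp_mul, ← integral_const_mul]
  refine integral_congr_ae ?_
  filter_upwards [(memLp_wickExp_smul s a).coeFn_toLp, (memLp_wickExp_smul t b).coeFn_toLp]
    with x h1 h2
  rw [h1, h2, real_inner_smul_left, real_inner_smul_right]
  ring

/-- The Gaussian Poincaré inequality for weakly differentiable functions. -/
theorem variance_stdGaussian_le {h : V → ℝ} {G : V → V} (hw : IsWeakGradientC1 h G)
    (hh : MemLp h 2 (stdGaussian V)) (hG : MemLp G 2 (stdGaussian V)) :
    variance h (stdGaussian V) ≤ ∫ x, ‖G x‖ ^ 2 ∂(stdGaussian V) := by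
  set γ := stdGaussian V
  set c : ℝ := ∫ x, h x ∂γ
  have hf : MemLp (fun x => h x - c) 2 γ := hh.sub (memLp_const c)
  have hhi : Integrable h γ := hh.integrable (by norm_num)
  -- `τ t` is `t ⊗ t` in coordinates. Then `q`, `r`, `m` below are respectively minus the generator,
  -- the gradient and the Hessian applied to `wickExp t`.
  let τ : V → EuclideanSpace ℝ (Fin (Module.finrank ℝ V) × Fin (Module.finrank ℝ V)) :=
    fun t => WithLp.toLp 2 fun ij =>
      ⟪stdOrthonormalBasis ℝ V ij.1, t⟫ * ⟪stdOrthonormalBasis ℝ V ij.2, t⟫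
  have hτ : ∀ s t, ⟪τ s, τ t⟫ = ⟪s, t⟫ ^ 2 := by
    intro s t
    have := (stdOrthonormalBasis ℝ V).sum_inner_mul_inner s t
    simp only [τ, PiLp.inner_apply, RCLike.inner_apply, conj_trivial, Fintype.sum_prod_type]
    rw [pow_two, ← this, Finset.sum_mul_sum]
    refine Finset.sum_congr rfl fun i _ => Finset.sum_congr rfl fun j _ => ?_
    rw [real_inner_comm _ s, real_inner_comm _ s]
    ring
  let q : V → Lp ℝ 2 γ := fun t => (memLp_wickGen t).toLp
  let r : V → Lp V 2 γ := fun t => (memLp_wickExp_smul t t).toLp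
  let m : V → Lp (EuclideanSpace ℝ (Fin (Module.finrank ℝ V) × Fin (Module.finrank ℝ V))) 2 γ :=
    fun t => (memLp_wickExp_smul t (τ t)).toLp
  have hqf : ∀ {u : V → ℝ} (hu : MemLp u 2 γ) t, ⟪hu.toLp u, q t⟫ = ∫ x, u x * wickGen t x ∂γ := by
    intro u hu t
    rw [L2.inner_def]
    refine integral_congr_ae ?_
    filter_upwards [hu.coeFn_toLp, (memLp_wickGen t).coeFn_toLp] with x h1 h2
    simp only [q, h1, h2, RCLike.inner_apply, conj_trivial, mul_comm]
  have gram : ∀ s t, ⟪q s, q t⟫ = ⟪r s, r t⟫ + ⟪m s, m t⟫ := by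
    intro s t
    simp only [r, m]
    rw [inner_toLp_wickExp_smul, inner_toLp_wickExp_smul, hτ, hqf, integral_wickGen_mul]
    ring
  have hpair : ∀ t, ⟪hf.toLp, q t⟫ = ⟪hG.toLp, r t⟫ := by
    intro t
    rw [hqf]
    have e1 : ∫ x, (h x - c) * wickGen t x ∂γ = ∫ x, h x * wickGen t x ∂γ := by
      simp_rw [sub_mul]
      rw [integral_sub (MemLp.integrable_fun_mul hh (memLp_wickGen t))
        (((memLp_wickGen t).integrable (by norm_num)).const_mul c), integral_const_mul,
        integral_wickGen]
      simp
    rw [e1, integral_mul_wickGen_eq hw hh hG, L2.inner_def]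
    refine integral_congr_ae ?_
    filter_upwards [hG.coeFn_toLp, (memLp_wickExp_smul t t).coeFn_toLp] with x h1 h2
    rw [h1, h2, real_inner_smul_right]; ring
  -- Double orthogonal: a function orthogonal to every `q t` is almost everywhere constant, hence
  -- orthogonal to the centered function `h - c`.
  have hcl : hf.toLp ∈ closure (Submodule.span ℝ (Set.range q) : Set (Lp ℝ 2 γ)) := by
    rw [← Submodule.topologicalClosure_coe, SetLike.mem_coe,
      ← Submodule.orthogonal_orthogonal_eq_closure, Submodule.mem_orthogonal]
    intro u hu
    have hu2 : MemLp u 2 γ := Lp.memLp u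
    have hui : Integrable u γ := hu2.integrable (by norm_num)
    have huq : ∀ t, ∫ x, u x * wickGen t x ∂γ = 0 := by
      intro t
      have := hu (q t) (Submodule.subset_span ⟨t, rfl⟩)
      rw [real_inner_comm, ← Lp.toLp_coeFn u hu2, hqf] at this
      exact this
    set d := ∫ x, u x ∂γ
    have hz := ae_eq_zero_of_integral_wickGen (k := fun x => u x - d)
      (hu2.sub (memLp_const d))
      (by rw [integral_sub hui (integrable_const _)]; simp [d, γ])
      (fun t => by
        simp_rw [sub_mul]
        rw [integral_sub (MemLp.integrable_fun_mul hu2 (memLp_wickGen t))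
          (((memLp_wickGen t).integrable (by norm_num)).const_mul d), integral_const_mul,
          integral_wickGen, huq]
        simp)
    rw [L2.inner_def]
    have : ∫ x, ⟪u x, hf.toLp _ x⟫ ∂γ = ∫ x, d * (h x - c) ∂γ := by
      refine integral_congr_ae ?_
      filter_upwards [hz, hf.coeFn_toLp] with x h1 h2
      have : u x = d := by simpa [sub_eq_zero] using h1
      rw [h2, this, RCLike.inner_apply, conj_trivial, mul_comm]
    rw [this, integral_const_mul, integral_sub hhi (integrable_const _)]
    simp [c, γ]
  have key := norm_le_of_gram_eq_add q r m gram hf.toLp hG.toLp hcl hpair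
  have key2 : ‖hf.toLp‖ ^ 2 ≤ ‖hG.toLp‖ ^ 2 := by gcongr
  rw [← real_inner_self_eq_norm_sq, ← real_inner_self_eq_norm_sq, L2.inner_def, L2.inner_def]
    at key2
  rw [variance_eq_integral hh.aestronglyMeasurable.aemeasurable]
  convert! key2 using 1
  · refine integral_congr_ae ?_
    filter_upwards [hf.coeFn_toLp] with x h1
    simp [h1, c]
  · refine integral_congr_ae ?_
    filter_upwards [hG.coeFn_toLp] with x h1
    rw [h1, real_inner_self_eq_norm_sq]

end GaussianPoincare

/-! ### Monotone transport on the line and its contraction property. -/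

section Transport

open Real Filter Topology Set

/-- `ν` has the continuous positive density `p` on the open interval `I` and no mass outside. -/
structure HasPosDensityOn (ν : Measure ℝ) (I : Set ℝ) (p : ℝ → ℝ) : Prop where
  isOpen : IsOpen I
  ordConnected : I.OrdConnected
  continuousOn : ContinuousOn p I
  pos : ∀ x ∈ I, 0 < p x
  eq_withDensity : ν = (volume.restrict I).withDensity fun x => ENNReal.ofReal (p x)

namespace HasPosDensityOn

variable {ν : Measure ℝ} [IsProbabilityMeasure ν] {I : Set ℝ} {p : ℝ → ℝ}

lemma eq_withDensity_indicator (h : HasPosDensityOn ν I p) :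
    ν = volume.withDensity fun x => ENNReal.ofReal (I.indicator p x) := by
  conv_lhs => rw [h.eq_withDensity, ← withDensity_indicator h.isOpen.measurableSet]
  congr 1
  ext x
  by_cases hx : x ∈ I <;> simp [hx]

lemma indicator_nonneg (h : HasPosDensityOn ν I p) : 0 ≤ I.indicator p :=
  Set.indicator_nonneg fun x hx => (h.pos x hx).le

lemma integrable (h : HasPosDensityOn ν I p) : Integrable (I.indicator p) := by
  have hm : AEStronglyMeasurable (I.indicator p) :=
    (aestronglyMeasurable_indicator_iff h.isOpen.measurableSet).2
      (h.continuousOn.aestronglyMeasurable h.isOpen.measurableSet)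
  refine ⟨hm, ?_⟩
  rw [hasFiniteIntegral_iff_ofReal (.of_forall h.indicator_nonneg)]
  have h1 : ν univ = 1 := measure_univ
  rw [h.eq_withDensity_indicator, withDensity_apply _ MeasurableSet.univ, setLIntegral_univ] at h1
  rw [h1]
  exact ENNReal.one_lt_top

lemma cdf_sub (h : HasPosDensityOn ν I p) (a b : ℝ) :
    cdf ν b - cdf ν a = ∫ t in a..b, I.indicator p t := by
  have hc : ∀ x, cdf ν x = ∫ t in Iic x, I.indicator p t := by
    intro x
    rw [cdf_eq_real, measureReal_def]
    conv_lhs => rw [h.eq_withDensity_indicator]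
    rw [withDensity_apply _ measurableSet_Iic, integral_eq_lintegral_of_nonneg_ae
      (.of_forall h.indicator_nonneg) h.integrable.aestronglyMeasurable.restrict]
  rw [hc, hc, intervalIntegral.integral_Iic_sub_Iic h.integrable.integrableOn
    h.integrable.integrableOn]

lemma continuous_cdf (h : HasPosDensityOn ν I p) : Continuous (cdf ν) := by
  have := intervalIntegral.continuous_primitive (μ := volume) (f := I.indicator p)
    (fun a b => h.integrable.intervalIntegrable) 0
  have e : ⇑(cdf ν) = fun x => cdf ν 0 + ∫ t in (0 : ℝ)..x, I.indicator p t := by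
    ext x; rw [← h.cdf_sub]; ring
  rw [e]
  fun_prop

lemma hasDerivAt_cdf (h : HasPosDensityOn ν I p) {x : ℝ} (hx : x ∈ I) :
    HasDerivAt (cdf ν) (p x) x := by
  have e : ⇑(cdf ν) = fun x => cdf ν 0 + ∫ t in (0 : ℝ)..x, I.indicator p t := by
    ext x; rw [← h.cdf_sub]; ring
  have hev : I.indicator p =ᶠ[𝓝 x] p := by
    filter_upwards [h.isOpen.mem_nhds hx] with y hy using Set.indicator_of_mem hy p
  have hcont : ContinuousAt (I.indicator p) x :=
    (h.continuousOn.continuousAt (h.isOpen.mem_nhds hx)).congr hev.symm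
  have := intervalIntegral.integral_hasDerivAt_right (a := 0) (b := x)
    h.integrable.intervalIntegrable
    ⟨univ, univ_mem, h.integrable.aestronglyMeasurable.restrict⟩ hcont
  rw [e]
  simpa [Set.indicator_of_mem hx] using this.const_add (cdf ν 0)

/-- Otherwise the cdf is constant on `[x, y]`, and its one-sided derivative at the endpoint lying in
`I` is 0 instead of `p > 0`. -/
lemma cdf_lt (h : HasPosDensityOn ν I p) {x y : ℝ} (hxy : x < y) (hI : x ∈ I ∨ y ∈ I) :
    cdf ν x < cdf ν y := by
  refine lt_of_le_of_ne (monotone_cdf ν hxy.le) fun heq => ?_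
  have hconst : ∀ z ∈ Icc x y, cdf ν z = cdf ν x := fun z hz =>
    le_antisymm (heq ▸ monotone_cdf ν hz.2) (monotone_cdf ν hz.1)
  rcases hI with hI | hI
  · have h1 : HasDerivWithinAt (cdf ν) (p x) (Icc x y) x := (h.hasDerivAt_cdf hI).hasDerivWithinAt
    have h2 : HasDerivWithinAt (cdf ν) 0 (Icc x y) x :=
      (hasDerivWithinAt_const x (Icc x y) (cdf ν x)).congr hconst rfl
    have := (uniqueDiffOn_Icc hxy x (left_mem_Icc.2 hxy.le)).eq_deriv _ h1 h2
    exact (h.pos x hI).ne' this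
  · have h1 : HasDerivWithinAt (cdf ν) (p y) (Icc x y) y := (h.hasDerivAt_cdf hI).hasDerivWithinAt
    have h2 : HasDerivWithinAt (cdf ν) 0 (Icc x y) y :=
      (hasDerivWithinAt_const y (Icc x y) (cdf ν x)).congr hconst heq.symm
    have := (uniqueDiffOn_Icc hxy y (right_mem_Icc.2 hxy.le)).eq_deriv _ h1 h2
    exact (h.pos y hI).ne' this

lemma cdf_mem_Ioo (h : HasPosDensityOn ν I p) {x : ℝ} (hx : x ∈ I) : cdf ν x ∈ Ioo (0 : ℝ) 1 :=
  ⟨(cdf_nonneg ν (x - 1)).trans_lt (h.cdf_lt (by linarith) (.inr hx)),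
    (h.cdf_lt (show x < x + 1 by linarith) (.inl hx)).trans_le (cdf_le_one ν _)⟩

lemma measure_compl (h : HasPosDensityOn ν I p) : ν Iᶜ = 0 := by
  rw [h.eq_withDensity, withDensity_apply _ h.isOpen.measurableSet.compl,
    Measure.restrict_restrict h.isOpen.measurableSet.compl]
  simp

/-- The intermediate value theorem gives a real `x`. If it were outside the interval `I`, all of `I`
would lie on one side of it and the cdf at `x` would be 0 or 1. -/
lemma exists_cdf_eq (h : HasPosDensityOn ν I p) {u : ℝ} (hu : u ∈ Ioo (0 : ℝ) 1) :
    ∃ x ∈ I, cdf ν x = u := by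
  obtain ⟨a, ha⟩ := ((tendsto_cdf_atBot ν).eventually (gt_mem_nhds hu.1)).exists
  obtain ⟨b, hb⟩ := ((tendsto_cdf_atTop ν).eventually (lt_mem_nhds hu.2)).exists
  obtain ⟨x, hx⟩ := mem_range_of_exists_le_of_exists_ge h.continuous_cdf ⟨a, ha.le⟩ ⟨b, hb.le⟩
  refine ⟨x, ?_, hx⟩
  by_contra hxI
  have hsplit : (∃ a ∈ I, a ≤ x) → (∃ b ∈ I, x ≤ b) → False := by
    rintro ⟨a, ha, hax⟩ ⟨b, hb, hxb⟩
    exact hxI (h.ordConnected.out ha hb ⟨hax, hxb⟩)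
  by_cases h1 : ∃ a ∈ I, a ≤ x
  · have h2 : Ioi x ⊆ Iᶜ := fun b hb hbI => hsplit h1 ⟨b, hbI, (mem_Ioi.1 hb).le⟩
    have h3 : ν (Iic x)ᶜ = 0 := by
      rw [compl_Iic]; exact measure_mono_null h2 h.measure_compl
    have h4 : ν (Iic x) = 1 := (prob_compl_eq_zero_iff measurableSet_Iic).1 h3
    rw [cdf_eq_real, measureReal_def, h4] at hx
    simp at hx
    exact hu.2.ne hx.symm
  · have h2 : Iic x ⊆ Iᶜ := fun b hb hbI => h1 ⟨b, hbI, hb⟩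
    rw [cdf_eq_real, measureReal_def, measure_mono_null h2 h.measure_compl] at hx
    simp at hx
    exact hu.1.ne hx

/-- The quantile function and its derivative. -/
lemma exists_quantile (h : HasPosDensityOn ν I p) : ∃ Q : ℝ → ℝ,
    (∀ u ∈ Ioo (0 : ℝ) 1, Q u ∈ I ∧ cdf ν (Q u) = u ∧ HasDerivAt Q (p (Q u))⁻¹ u) ∧
    ∀ x ∈ I, Q (cdf ν x) = x := by
  choose! Q hQI hQ using fun u (hu : u ∈ Ioo (0 : ℝ) 1) => h.exists_cdf_eq hu
  have hmono : StrictMonoOn Q (Ioo 0 1) := by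
    intro u hu v hv huv
    by_contra hle
    have := monotone_cdf ν (not_lt.1 hle)
    rw [hQ u hu, hQ v hv] at this
    linarith
  have hleft : ∀ x ∈ I, Q (cdf ν x) = x := by
    intro x hx
    have hu := h.cdf_mem_Ioo hx
    rcases lt_trichotomy (Q (cdf ν x)) x with hlt | heq | hgt
    · have := h.cdf_lt hlt (.inr hx)
      rw [hQ _ hu] at this
      exact absurd this (lt_irrefl _)
    · exact heq
    · have := h.cdf_lt hgt (.inl hx)
      rw [hQ _ hu] at this
      exact absurd this (lt_irrefl _)
  refine ⟨Q, fun u hu => ⟨hQI u hu, hQ u hu, ?_⟩, hleft⟩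
  have hnhds : Ioo (0 : ℝ) 1 ∈ 𝓝 u := isOpen_Ioo.mem_nhds hu
  have himg : I ⊆ Q '' Ioo 0 1 := fun x hx => ⟨cdf ν x, h.cdf_mem_Ioo hx, hleft x hx⟩
  -- A monotone function can only fail continuity by a jump, and the image of `Q` contains `I`, a
  -- neighbourhood of `Q u`.
  have hcont : ContinuousAt Q u := hmono.continuousAt_of_image_mem_nhds hnhds
    (mem_of_superset (h.isOpen.mem_nhds (hQI u hu)) himg)
  exact (h.hasDerivAt_cdf (hQI u hu)).of_local_left_inverse hcont (h.pos _ (hQI u hu)).ne'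
    (by filter_upwards [hnhds] with v hv using hQ v hv)

end HasPosDensityOn

lemma hasDerivAt_gaussianPDFReal (x : ℝ) :
    HasDerivAt (gaussianPDFReal 0 1) (-x * gaussianPDFReal 0 1 x) x := by
  have h1 : HasDerivAt (fun x : ℝ => -(x - 0) ^ 2 / (2 * ((1 : NNReal) : ℝ))) (-x) x := by
    have := (((hasDerivAt_id x).sub_const 0).pow 2).neg.div_const (2 * ((1 : NNReal) : ℝ))
    convert! this using 1
    simp
    ring
  have h2 := (h1.exp).const_mul (√(2 * π * ((1 : NNReal) : ℝ)))⁻¹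
  rw [gaussianPDFReal_def]
  convert! h2 using 1
  ring

lemma hasPosDensityOn_gaussianReal : HasPosDensityOn (gaussianReal 0 1) univ
    (gaussianPDFReal 0 1) where
  isOpen := isOpen_univ
  ordConnected := ordConnected_univ
  continuousOn := continuousOn_of_forall_continuousAt fun x _ =>
    (hasDerivAt_gaussianPDFReal x).continuousAt
  pos x _ := gaussianPDFReal_pos 0 1 x one_ne_zero
  eq_withDensity := by
    rw [gaussianReal_of_var_ne_zero _ one_ne_zero, Measure.restrict_univ]
    rfl

lemma tendsto_gaussianPDFReal_cocompact :
    Tendsto (gaussianPDFReal 0 1) (cocompact ℝ) (𝓝 0) := by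
  have h := tendsto_rpow_abs_mul_exp_neg_mul_sq_cocompact (a := 1 / 2) (by norm_num) 0
  have := h.const_mul (√(2 * π * ((1 : NNReal) : ℝ)))⁻¹
  rw [mul_zero] at this
  refine this.congr fun x => ?_
  simp only [gaussianPDFReal, rpow_zero, one_mul, sub_zero, NNReal.coe_one, mul_one]
  ring_nf

/-- One-dimensional contraction principle, in terms of densities. -/
lemma sqrt_mul_gaussianPDFReal_le {κ : ℝ} (hκ : 0 < κ) {I : Set ℝ} {V T : ℝ → ℝ} (hI : IsOpen I)
    (hV : DifferentiableOn ℝ V I) (hV' : DifferentiableOn ℝ (deriv V) I)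
    (hV'' : ∀ x ∈ I, κ ≤ deriv (deriv V) x) (hTI : ∀ y, T y ∈ I)
    (hT : ∀ y, HasDerivAt T (gaussianPDFReal 0 1 y * (exp (-V (T y)))⁻¹) y) (y : ℝ) :
    √κ * gaussianPDFReal 0 1 y ≤ exp (-V (T y)) := by
  set φ := gaussianPDFReal 0 1
  have hφpos : ∀ y, 0 < φ y := fun y => gaussianPDFReal_pos 0 1 y one_ne_zero
  -- As `T' = φ / exp (-V ∘ T)`, the claim is `D ≤ 0`, and `D' = φ * E`. At a positive maximum `E =
  -- 0` and `T' > 1 / √κ`, so `D'' = φ * (V''(T) * T' - √κ) > 0`, which is absurd.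
  let D : ℝ → ℝ := fun y => √κ * φ y - exp (-V (T y))
  let E : ℝ → ℝ := fun y => deriv V (T y) - √κ * y
  have hD : ∀ y, HasDerivAt D (φ y * E y) y := by
    intro y
    have h1 := (hV.differentiableAt (hI.mem_nhds (hTI y))).hasDerivAt
    have h2 := ((h1.comp y (hT y)).neg).exp
    have h3 := ((hasDerivAt_gaussianPDFReal y).const_mul (√κ)).sub h2
    convert! h3 using 1
    have := (exp_pos (-V (T y))).ne'
    simp only [E, φ, Pi.neg_apply, Function.comp_apply]
    field_simp
    ring
  have hE : ∀ y, HasDerivAt E (deriv (deriv V) (T y) * (φ y * (exp (-V (T y)))⁻¹) - √κ) y := by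
    intro y
    have h1 := (hV'.differentiableAt (hI.mem_nhds (hTI y))).hasDerivAt
    have h2 := (h1.comp y (hT y)).sub ((hasDerivAt_id y).const_mul (√κ))
    convert! h2 using 1
    simp
  have hDc : Continuous D := continuous_iff_continuousAt.2 fun y => (hD y).continuousAt
  by_contra hlt
  have hpos : 0 < D y := sub_pos.2 (not_le.1 hlt)
  -- The maximum is attained: `D` lies below `√κ * φ`, which tends to 0 at infinity.
  obtain ⟨y₀, hy₀⟩ := hDc.exists_forall_ge' y (by
    have h := tendsto_gaussianPDFReal_cocompact.const_mul (√κ)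
    rw [mul_zero] at h
    filter_upwards [h.eventually (gt_mem_nhds hpos)] with z hz
    have := exp_pos (-V (T z))
    simp only [D] at hz ⊢
    linarith)
  have hD0 : 0 < D y₀ := hpos.trans_le (hy₀ y)
  have hmax : IsLocalMax D y₀ := .of_forall hy₀
  have hE0 : E y₀ = 0 :=
    (mul_eq_zero.1 (hmax.hasDerivAt_eq_zero (hD y₀))).resolve_left (hφpos _).ne'
  have hderiv : deriv D = fun y => φ y * E y := funext fun y => (hD y).deriv
  have hsecond : 0 < deriv (deriv D) y₀ := by
    rw [hderiv]
    change 0 < deriv (φ * E) y₀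
    rw [((hasDerivAt_gaussianPDFReal y₀).mul (hE y₀)).deriv, hE0, mul_zero, zero_add]
    refine mul_pos (hφpos _) (sub_pos.2 ?_)
    have hp := exp_pos (-V (T y₀))
    have h1 : exp (-V (T y₀)) < √κ * φ y₀ := sub_pos.1 hD0
    have h2 : 1 < √κ * (φ y₀ * (exp (-V (T y₀)))⁻¹) := by
      rw [← mul_assoc, ← div_eq_mul_inv, one_lt_div hp]; exact h1
    have h3 : 0 < φ y₀ * (exp (-V (T y₀)))⁻¹ := mul_pos (hφpos _) (inv_pos.2 hp)
    calc √κ = √κ * 1 := (mul_one _).symm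
      _ < √κ * (√κ * (φ y₀ * (exp (-V (T y₀)))⁻¹)) :=
        mul_lt_mul_of_pos_left h2 (Real.sqrt_pos.2 hκ)
      _ = κ * (φ y₀ * (exp (-V (T y₀)))⁻¹) := by
        rw [← mul_assoc, Real.mul_self_sqrt hκ.le]
      _ ≤ _ := mul_le_mul_of_nonneg_right (hV'' _ (hTI y₀)) h3.le
  have hmin := isLocalMin_of_deriv_deriv_pos hsecond
    (by rw [hderiv]; simp [hE0]) hDc.continuousAt
  -- Being both a local minimum and a global maximum makes `D` locally constant, against `D'' > 0`.
  -- Only the existence of `D''` at `y₀` matters, so `V''` need not be continuous.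
  have hconst : D =ᶠ[𝓝 y₀] fun _ => D y₀ := by
    filter_upwards [hmin] with z hz using le_antisymm (hy₀ z) hz
  have : deriv (deriv D) y₀ = 0 := by
    rw [hconst.deriv.deriv_eq]; simp
  exact hsecond.ne' this

/-- The data of the monotone transport of the standard Gaussian to `ν`: `T` is the transport map,
`S` its inverse on the interval `I`, and `T'`, `S'` are their derivatives. -/
structure IsGaussianTransport (ν : Measure ℝ) (κ : ℝ) (I : Set ℝ) (T T' S S' : ℝ → ℝ) :
    Prop where
  isOpen : IsOpen I
  ordConnected : I.OrdConnected
  mem : ∀ y, T y ∈ I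
  left_inv : ∀ y, S (T y) = y
  right_inv : ∀ x ∈ I, T (S x) = x
  hasDerivAt : ∀ y, HasDerivAt T (T' y) y
  deriv_pos : ∀ y, 0 < T' y
  deriv_sq_le : ∀ y, T' y ^ 2 ≤ 1 / κ
  hasDerivAt_inv : ∀ x ∈ I, HasDerivAt S (S' x) x
  contDiffOn_inv : ContDiffOn ℝ 1 S I
  contDiffOn_deriv_inv : ContDiffOn ℝ 1 S' I
  deriv_inv_mul : ∀ y, S' (T y) * T' y = 1
  le_iff : ∀ y x, T y ≤ x ↔ cdf (gaussianReal 0 1) y ≤ cdf ν x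

lemma contDiffOn_one_of_hasDerivAt {f f' : ℝ → ℝ} {I : Set ℝ} (hI : IsOpen I)
    (hf : ∀ x ∈ I, HasDerivAt f (f' x) x) (hf' : ContinuousOn f' I) : ContDiffOn ℝ 1 f I := by
  rw [show (1 : WithTop ℕ∞) = 0 + 1 from (zero_add 1).symm,
    contDiffOn_succ_iff_deriv_of_isOpen hI]
  refine ⟨fun x hx => (hf x hx).differentiableAt.differentiableWithinAt, by simp, ?_⟩
  rw [contDiffOn_zero]
  exact hf'.congr fun x hx => (hf x hx).deriv

/-- Take `T = Q ∘ Φ` and `S = R ∘ F` with `Q`, `R` the quantile functions of `ν` and of the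
Gaussian. Since `V` is `C¹`, so is `S' = exp (-V) / φ(S)`; this is needed because `S'` will be a
factor of test functions. -/
lemma exists_isGaussianTransport (ν : Measure ℝ) [IsProbabilityMeasure ν] {κ : ℝ} (hκ : 0 < κ)
    (h : HasLogConcaveDensity ν κ) :
    ∃ I T T' S S', IsGaussianTransport ν κ I T T' S S' := by
  obtain ⟨I, V, hI, hIc, hν, hV, hV', hV''⟩ := h
  have hp : HasPosDensityOn ν I fun x => exp (-V x) :=
    ⟨hI, hIc, by have := hV.continuousOn; fun_prop, fun x _ => exp_pos _, hν⟩
  have hg := hasPosDensityOn_gaussianReal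
  obtain ⟨Q, hQ, hQ'⟩ := hp.exists_quantile
  obtain ⟨R, hR, hR'⟩ := hg.exists_quantile
  set Φ := cdf (gaussianReal 0 1)
  set φ := gaussianPDFReal 0 1
  have hΦ : ∀ y, Φ y ∈ Ioo (0 : ℝ) 1 := fun y => hg.cdf_mem_Ioo (mem_univ y)
  have hφpos : ∀ y, 0 < φ y := fun y => gaussianPDFReal_pos 0 1 y one_ne_zero
  have hφ1 : ContDiff ℝ 1 φ := by
    simp only [φ, gaussianPDFReal_def]; fun_prop
  have hT : ∀ y, HasDerivAt (fun y => Q (Φ y)) (φ y * (exp (-V (Q (Φ y))))⁻¹) y := by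
    intro y
    have := (hQ _ (hΦ y)).2.2.comp y (hg.hasDerivAt_cdf (mem_univ y))
    rwa [mul_comm] at this
  have hS : ∀ x ∈ I, HasDerivAt (fun x => R (cdf ν x))
      ((φ (R (cdf ν x)))⁻¹ * exp (-V x)) x := fun x hx =>
    (hR _ (hp.cdf_mem_Ioo hx)).2.2.comp x (hp.hasDerivAt_cdf hx)
  have hV1 : ContDiffOn ℝ 1 V I := contDiffOn_one_of_hasDerivAt hI
    (fun x hx => (hV.differentiableAt (hI.mem_nhds hx)).hasDerivAt) hV'.continuousOn
  have hSc : ContinuousOn (fun x => R (cdf ν x)) I := fun x hx =>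
    (hS x hx).continuousAt.continuousWithinAt
  have hS1 : ContDiffOn ℝ 1 (fun x => R (cdf ν x)) I := by
    refine contDiffOn_one_of_hasDerivAt hI hS (ContinuousOn.mul (ContinuousOn.inv₀
      (hφ1.continuous.comp_continuousOn hSc) fun x _ => (hφpos _).ne') ?_)
    have := hV.continuousOn
    fun_prop
  have hTS : ∀ y, R (cdf ν (Q (Φ y))) = y := fun y => by
    rw [(hQ _ (hΦ y)).2.1, hR' y (mem_univ y)]
  refine ⟨I, fun y => Q (Φ y), fun y => φ y * (exp (-V (Q (Φ y))))⁻¹, fun x => R (cdf ν x),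
    fun x => (φ (R (cdf ν x)))⁻¹ * exp (-V x), hI, hIc, fun y => (hQ _ (hΦ y)).1, hTS, ?_, hT,
    fun y => mul_pos (hφpos y) (inv_pos.2 (exp_pos _)), ?_, hS, hS1, ?_, ?_, ?_⟩
  · intro x hx
    simp only [Φ]
    rw [(hR _ (hp.cdf_mem_Ioo hx)).2.1, hQ' x hx]
  · intro y
    have h1 := sqrt_mul_gaussianPDFReal_le hκ hI hV hV' hV'' (fun y => (hQ _ (hΦ y)).1) hT y
    have h2 : √κ * (φ y * (exp (-V (Q (Φ y))))⁻¹) ≤ 1 := by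
      rw [← mul_assoc, ← div_eq_mul_inv, div_le_one (exp_pos _)]; exact h1
    have h3 : 0 ≤ √κ * (φ y * (exp (-V (Q (Φ y))))⁻¹) := by
      have := hφpos y
      positivity
    rw [le_div_iff₀ hκ]
    calc _ = (√κ * (φ y * (exp (-V (Q (Φ y))))⁻¹)) ^ 2 := by
          rw [mul_pow (√κ), Real.sq_sqrt hκ.le]; ring
      _ ≤ 1 := pow_le_one₀ h3 h2
  · exact ((hφ1.comp_contDiffOn hS1).inv fun x _ => (hφpos _).ne').mul
      (hV1.neg.exp)
  · intro y
    simp only [hTS]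
    have := (hφpos y).ne'
    have := (exp_pos (-V (Q (Φ y)))).ne'
    field_simp
  · intro y x
    constructor
    · intro hle
      have := monotone_cdf ν hle
      rwa [(hQ _ (hΦ y)).2.1] at this
    · intro hle
      by_contra hlt
      have := hp.cdf_lt (not_le.1 hlt) (.inr (hQ _ (hΦ y)).1)
      rw [(hQ _ (hΦ y)).2.1] at this
      linarith

end Transport

/-! ### From smooth to `C¹` test functions. -/

section Mollification

open Real Filter Topology Set Metric

variable {n : ℕ}

lemma integrableOn_mul_of_eq_zero_off {Ω K : Set (EuclideanSpace ℝ (Fin n))} (hΩ : IsOpen Ω)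
    (hK : IsCompact K) (hKΩ : K ⊆ Ω) {f u : EuclideanSpace ℝ (Fin n) → ℝ}
    (hf : LocallyIntegrableOn f Ω) (hu : Continuous u) (hu0 : ∀ x, x ∉ K → u x = 0) :
    IntegrableOn (fun x => f x * u x) Ω :=
  ((hf.integrableOn_compact_subset hKΩ hK).mul_continuousOn hu.continuousOn
    hK).of_forall_sdiff_eq_zero hΩ.measurableSet fun x hx => by rw [hu0 x hx.2, mul_zero]

lemma tendsto_setIntegral_mul {Ω K : Set (EuclideanSpace ℝ (Fin n))} (hΩ : IsOpen Ω)
    (hK : IsCompact K) (hKΩ : K ⊆ Ω) {f u : EuclideanSpace ℝ (Fin n) → ℝ}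
    (hf : LocallyIntegrableOn f Ω) {v : ℕ → EuclideanSpace ℝ (Fin n) → ℝ} {C : ℝ}
    (hv : ∀ k, Continuous (v k)) (hv0 : ∀ k x, x ∉ K → v k x = 0) (hvC : ∀ k x, ‖v k x‖ ≤ C)
    (hlim : ∀ x, Tendsto (fun k => v k x) atTop (𝓝 (u x))) :
    Tendsto (fun k => ∫ x in Ω, f x * v k x) atTop (𝓝 (∫ x in Ω, f x * u x)) := by
  have hfK := hf.integrableOn_compact_subset hKΩ hK
  refine tendsto_integral_of_dominated_convergence (fun x => K.indicator (fun x => ‖f x‖ * C) x)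
    (fun k => (integrableOn_mul_of_eq_zero_off hΩ hK hKΩ hf (hv k) (hv0 k)).aestronglyMeasurable)
    ?_ ?_ ?_
  · have h1 : Integrable (K.indicator fun x => ‖f x‖ * C) :=
      (integrable_indicator_iff hK.measurableSet).2 (hfK.norm.mul_const C)
    exact h1.integrableOn
  · refine fun k => .of_forall fun x => ?_
    by_cases hx : x ∈ K
    · rw [indicator_of_mem hx, norm_mul]
      exact mul_le_mul_of_nonneg_left (hvC k x) (norm_nonneg _)
    · rw [indicator_of_notMem hx, hv0 k x hx, mul_zero, norm_zero]
  · exact .of_forall fun x => (hlim x).const_mul _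

/-- The integration by parts formula defining weak gradients extends to `C¹` test functions. -/
lemma HasWeakGradient.integral_eq_of_contDiff_one {Ω : Set (EuclideanSpace ℝ (Fin n))}
    (hΩ : IsOpen Ω) {f : EuclideanSpace ℝ (Fin n) → ℝ}
    {g : EuclideanSpace ℝ (Fin n) → EuclideanSpace ℝ (Fin n)} (h : HasWeakGradient Ω f g)
    {ψ : EuclideanSpace ℝ (Fin n) → ℝ} (hψ : ContDiff ℝ 1 ψ) (hψc : HasCompactSupport ψ)
    (hψΩ : tsupport ψ ⊆ Ω) (i : Fin n) :
    ∫ x in Ω, f x * fderiv ℝ ψ x (EuclideanSpace.single i 1) = -∫ x in Ω, g x i * ψ x := by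
  -- Mollifying at radius at most `δ` keeps all supports in one compact `K ⊆ Ω`, on which `f` and
  -- `g` are integrable; dominated convergence then applies.
  obtain ⟨δ, hδ, hδΩ⟩ := hψc.isCompact.exists_cthickening_subset_open hΩ hψΩ
  set K := cthickening δ (tsupport ψ)
  have hK : IsCompact K := hψc.isCompact.cthickening
  have hgi : LocallyIntegrableOn (fun x => g x i) Ω := by
    intro x hx
    obtain ⟨s, hs, hs'⟩ := h.2.1 x hx
    exact ⟨s, hs, (EuclideanSpace.proj (𝕜 := ℝ) i).integrable_comp hs'⟩
  let η : ℕ → ContDiffBump (0 : EuclideanSpace ℝ (Fin n)) := fun k =>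
    ⟨δ / (k + 1) / 2, δ / (k + 1), by positivity, half_lt_self (by positivity)⟩
  have hη : Tendsto (fun k => (η k).rOut) atTop (𝓝 0) := by
    simpa [η, div_eq_mul_inv] using (tendsto_one_div_add_atTop_nhds_zero_nat (𝕜 := ℝ)).const_mul δ
  have hηδ : ∀ k, (η k).rOut ≤ δ := fun k => div_le_self hδ.le (by simp)
  let u : EuclideanSpace ℝ (Fin n) → ℝ := fun x => fderiv ℝ ψ x (EuclideanSpace.single i 1)
  have hu : Continuous u := (hψ.continuous_fderiv one_ne_zero).clm_apply continuous_const
  have huc : HasCompactSupport u := hψc.fderiv_apply (𝕜 := ℝ) _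
  let conv : ℕ → (EuclideanSpace ℝ (Fin n) → ℝ) → EuclideanSpace ℝ (Fin n) → ℝ := fun k w =>
    convolution ((η k).normed volume) w (ContinuousLinearMap.lsmul ℝ ℝ) volume
  have hηint : ∀ k, LocallyIntegrable ((η k).normed volume) (volume : Measure
      (EuclideanSpace ℝ (Fin n))) := fun k => (η k).integrable_normed.locallyIntegrable
  have hsmooth : ∀ k, ContDiff ℝ ∞ (conv k ψ) := fun k =>
    (η k).hasCompactSupport_normed.contDiff_convolution_left _ (η k).contDiff_normed
      hψ.continuous.locallyIntegrable
  have hcs : ∀ k, HasCompactSupport (conv k ψ) := fun k =>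
    HasCompactSupport.convolution _ (η k).hasCompactSupport_normed hψc
  have hts : ∀ k, tsupport (conv k ψ) ⊆ K := by
    intro k
    refine closure_minimal ?_ isClosed_cthickening
    refine (support_convolution_subset _).trans ?_
    rw [(η k).support_normed_eq]
    rintro _ ⟨a, ha, b, hb, rfl⟩
    refine mem_cthickening_of_dist_le _ b δ _ (subset_tsupport _ hb) ?_
    rw [mem_ball_zero_iff] at ha
    simpa using ha.le.trans (hηδ k)
  have hfd : ∀ k x, fderiv ℝ (conv k ψ) x (EuclideanSpace.single i 1) = conv k u x := by
    intro k x
    rw [(hψc.hasFDerivAt_convolution_right _ (hηint k) hψ x).fderiv,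
      convolution_precompR_apply _ (hηint k) (hψc.fderiv (𝕜 := ℝ))
      (hψ.continuous_fderiv one_ne_zero)]
  have hbound : ∀ w : EuclideanSpace ℝ (Fin n) → ℝ, Continuous w → HasCompactSupport w →
      ∃ C, ∀ k x, ‖conv k w x‖ ≤ C := by
    intro w hw hwc
    obtain ⟨C, hC⟩ := hwc.exists_bound_of_continuous hw
    -- An average of `w` differs from `w x` by at most the oscillation `2 * C`, and `‖w x‖ ≤ C`.
    refine ⟨2 * C + C, fun k x => ?_⟩
    have h1 := (η k).dist_normed_convolution_le (μ := volume) (x₀ := x) (ε := 2 * C)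
      hw.aestronglyMeasurable (fun y _ => by
        rw [dist_eq_norm]
        exact (norm_sub_le _ _).trans (by linarith [hC x, hC y]))
    rw [dist_eq_norm] at h1
    calc ‖conv k w x‖ = ‖(conv k w x - w x) + w x‖ := by rw [sub_add_cancel]
      _ ≤ _ := (norm_add_le _ _).trans (add_le_add h1 (hC x))
  have hptw : ∀ w : EuclideanSpace ℝ (Fin n) → ℝ, Continuous w → ∀ x,
      Tendsto (fun k => conv k w x) atTop (𝓝 (w x)) := fun w hw x =>
    ContDiffBump.convolution_tendsto_right_of_continuous hη hw x
  have hzero : ∀ k x, x ∉ K → conv k ψ x = 0 := fun k x hx =>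
    image_eq_zero_of_notMem_tsupport fun hx' => hx (hts k hx')
  have hzero' : ∀ k x, x ∉ K → conv k u x = 0 := fun k x hx => by
    rw [← hfd, fderiv_of_notMem_tsupport ℝ (fun hx' => hx (hts k hx'))]
    rfl
  have hcu : ∀ k, Continuous (conv k u) := fun k => by
    simp_rw [funext fun x => (hfd k x).symm]
    exact ((hsmooth k).continuous_fderiv (by simp)).clm_apply continuous_const
  obtain ⟨C₁, hC₁⟩ := hbound u hu huc
  obtain ⟨C₂, hC₂⟩ := hbound ψ hψ.continuous hψc
  have l1 := tendsto_setIntegral_mul hΩ hK hδΩ h.1 hcu hzero' hC₁ (hptw u hu)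
  have l2 := (tendsto_setIntegral_mul hΩ hK hδΩ hgi (fun k => (hsmooth k).continuous) hzero hC₂
    (hptw ψ hψ.continuous)).neg
  have e : ∀ k, ∫ x in Ω, f x * conv k u x = -∫ x in Ω, g x i * conv k ψ x := by
    intro k
    simp_rw [← hfd]
    exact h.2.2 (conv k ψ) (hsmooth k) (hcs k) ((hts k).trans hδΩ) i
  simp_rw [e] at l1
  exact tendsto_nhds_unique l1 l2

end Mollification

/-! ### Weak gradients under linear maps. -/

section ChangeOfVariables

open scoped RealInnerProductSpace

variable {n : ℕ}

/-- Weak gradients pull back under invertible linear maps. -/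
lemma IsWeakGradientC1.comp_linear {h : EuclideanSpace ℝ (Fin n) → ℝ}
    {G : EuclideanSpace ℝ (Fin n) → EuclideanSpace ℝ (Fin n)} (hw : IsWeakGradientC1 h G)
    (M : EuclideanSpace ℝ (Fin n) ≃L[ℝ] EuclideanSpace ℝ (Fin n))
    (N : EuclideanSpace ℝ (Fin n) →L[ℝ] EuclideanSpace ℝ (Fin n))
    (hN : ∀ x y, ⟪N x, y⟫ = ⟪x, M y⟫) :
    IsWeakGradientC1 (fun z => h (M z)) (fun z => N (G (M z))) := by
  intro φ hφ hφc w
  have hdet : (M : EuclideanSpace ℝ (Fin n) →L[ℝ] EuclideanSpace ℝ (Fin n)).det ≠ 0 :=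
    M.toLinearEquiv.isUnit_det'.ne_zero
  have hcv : ∀ F : EuclideanSpace ℝ (Fin n) → ℝ, ∫ x, F x =
      |(M : EuclideanSpace ℝ (Fin n) →L[ℝ] EuclideanSpace ℝ (Fin n)).det| * ∫ x, F (M x) := by
    intro F
    have := integral_image_eq_integral_abs_det_fderiv_smul volume MeasurableSet.univ
      (fun x _ => M.hasFDerivAt.hasFDerivWithinAt) M.injective.injOn F
    rw [Set.image_univ_of_surjective M.surjective, setIntegral_univ, setIntegral_univ] at this
    rw [this, ← integral_const_mul]
    rfl
  -- Testing with `φ ∘ M⁻¹` in the direction `M w` reproduces the derivative of `φ` along `w`. Both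
  -- sides acquire the same Jacobian, which cancels.
  have h1 := hw (fun x => φ (M.symm x)) (hφ.comp M.symm.contDiff)
    (hφc.comp_homeomorph M.symm.toHomeomorph) (M w)
  rw [hcv (fun x => h x * _), hcv (fun x => ⟪G x, M w⟫ * _)] at h1
  have hfd : ∀ x, fderiv ℝ (fun x => φ (M.symm x)) (M x) (M w) = fderiv ℝ φ x w := by
    intro x
    have h2 := ((hφ.differentiable one_ne_zero) (M.symm (M x))).hasFDerivAt.comp (M x)
      M.symm.hasFDerivAt
    have h3 : fderiv ℝ (fun x => φ (M.symm x)) (M x) = _ := h2.fderiv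
    rw [h3]
    simp
  simp only [hfd, ContinuousLinearEquiv.symm_apply_apply, ← hN] at h1
  rw [← mul_neg] at h1
  exact mul_left_cancel₀ (abs_ne_zero.2 hdet) h1

end ChangeOfVariables

/-! ### Weak gradients under coordinatewise transport. -/

section BoxTransport

open Real Filter Topology Set
open scoped RealInnerProductSpace

variable {n : ℕ}

/-- A map acting coordinatewise on Euclidean space. -/
def coordMap (T : Fin n → ℝ → ℝ) (y : EuclideanSpace ℝ (Fin n)) : EuclideanSpace ℝ (Fin n) :=
  WithLp.toLp 2 fun i => T i (y i)

/-- The box with the given sides. -/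
def coordBox (I : Fin n → Set ℝ) : Set (EuclideanSpace ℝ (Fin n)) := {x | ∀ i, x i ∈ I i}

@[simp] lemma coordMap_apply (T : Fin n → ℝ → ℝ) (y : EuclideanSpace ℝ (Fin n)) (i : Fin n) :
    coordMap T y i = T i (y i) := rfl

lemma hasFDerivAt_coordMap {T : Fin n → ℝ → ℝ} {d : Fin n → ℝ} {y : EuclideanSpace ℝ (Fin n)}
    (h : ∀ i, HasDerivAt (T i) (d i) (y i)) :
    HasFDerivAt (coordMap T) (Matrix.toEuclideanCLM (𝕜 := ℝ) (Matrix.diagonal d)) y := by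
  rw [← hasFDerivWithinAt_univ, hasFDerivWithinAt_euclidean]
  intro i
  rw [hasFDerivWithinAt_univ]
  have h1 : HasFDerivAt (fun x : EuclideanSpace ℝ (Fin n) => x i)
      (EuclideanSpace.proj (𝕜 := ℝ) i) y := (EuclideanSpace.proj (𝕜 := ℝ) i).hasFDerivAt
  have h2 := (h i).comp_hasFDerivAt y h1
  convert! h2 using 1
  ext v
  simp [Matrix.ofLp_toEuclideanCLM, Matrix.mulVec_diagonal]

lemma det_toEuclideanCLM_diagonal (d : Fin n → ℝ) :
    (Matrix.toEuclideanCLM (𝕜 := ℝ) (Matrix.diagonal d)).det = ∏ i, d i := by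
  rw [ContinuousLinearMap.det, Matrix.coe_toEuclideanCLM_eq_toEuclideanLin,
    LinearMap.det_toLpLin, Matrix.det_diagonal]

lemma isOpen_coordBox {I : Fin n → Set ℝ} (hI : ∀ i, IsOpen (I i)) : IsOpen (coordBox I) := by
  have : coordBox I = ⋂ i, (fun x : EuclideanSpace ℝ (Fin n) => x i) ⁻¹' I i := by
    ext x; simp [coordBox]
  rw [this]
  exact isOpen_iInter_of_finite fun i => (hI i).preimage (by fun_prop)

variable {ν : Fin n → Measure ℝ} {κ : Fin n → ℝ} {I : Fin n → Set ℝ} {T T' S S' : Fin n → ℝ → ℝ}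

lemma image_coordMap_univ
    (h : ∀ i, IsGaussianTransport (ν i) (κ i) (I i) (T i) (T' i) (S i) (S' i)) :
    coordMap T '' univ = coordBox I := by
  ext x
  constructor
  · rintro ⟨y, -, rfl⟩ i
    exact (h i).mem _
  · intro hx
    refine ⟨coordMap S x, mem_univ _, ?_⟩
    ext i
    exact (h i).right_inv _ (hx i)

lemma coordMap_leftInverse
    (h : ∀ i, IsGaussianTransport (ν i) (κ i) (I i) (T i) (T' i) (S i) (S' i)) :
    Function.LeftInverse (coordMap S) (coordMap T) := fun y => by
  ext i
  exact (h i).left_inv _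

lemma continuous_coordMap
    (h : ∀ i, IsGaussianTransport (ν i) (κ i) (I i) (T i) (T' i) (S i) (S' i)) :
    Continuous (coordMap T) :=
  continuous_iff_continuousAt.2 fun _ =>
    (hasFDerivAt_coordMap fun i => (h i).hasDerivAt _).continuousAt

lemma integral_coordBox_eq
    (h : ∀ i, IsGaussianTransport (ν i) (κ i) (I i) (T i) (T' i) (S i) (S' i))
    (F : EuclideanSpace ℝ (Fin n) → ℝ) :
    ∫ x in coordBox I, F x = ∫ y, (∏ i, T' i (y i)) * F (coordMap T y) := by
  have := integral_image_eq_integral_abs_det_fderiv_smul volume MeasurableSet.univ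
    (fun x _ => (hasFDerivAt_coordMap fun i => (h i).hasDerivAt _).hasFDerivWithinAt)
    (coordMap_leftInverse h).injective.injOn F
  rw [image_coordMap_univ h, setIntegral_univ] at this
  rw [this]
  refine integral_congr_ae (.of_forall fun y => ?_)
  simp only [det_toEuclideanCLM_diagonal, smul_eq_mul]
  rw [abs_of_pos (Finset.prod_pos fun i _ => (h i).deriv_pos _)]

lemma integrableOn_coordBox_iff
    (h : ∀ i, IsGaussianTransport (ν i) (κ i) (I i) (T i) (T' i) (S i) (S' i))
    (F : EuclideanSpace ℝ (Fin n) → ℝ) :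
    IntegrableOn F (coordBox I) ↔
      Integrable fun y => (∏ i, T' i (y i)) * F (coordMap T y) := by
  have := integrableOn_image_iff_integrableOn_abs_det_fderiv_smul volume MeasurableSet.univ
    (fun x _ => (hasFDerivAt_coordMap fun i => (h i).hasDerivAt _).hasFDerivWithinAt)
    (coordMap_leftInverse h).injective.injOn F
  rw [image_coordMap_univ h, integrableOn_univ] at this
  rw [this]
  refine integrable_congr (.of_forall fun y => ?_)
  simp only [det_toEuclideanCLM_diagonal, smul_eq_mul]
  rw [abs_of_pos (Finset.prod_pos fun i _ => (h i).deriv_pos _)]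

/-- The test function on the box corresponding to the test function `φ` on the whole space, for
the `i`-th weak derivative. -/
lemma exists_pullback_test
    (h : ∀ i, IsGaussianTransport (ν i) (κ i) (I i) (T i) (T' i) (S i) (S' i))
    {φ : EuclideanSpace ℝ (Fin n) → ℝ} (hφ : ContDiff ℝ 1 φ) (hφc : HasCompactSupport φ)
    (i : Fin n) :
    ∃ ψ : EuclideanSpace ℝ (Fin n) → ℝ, ContDiff ℝ 1 ψ ∧ HasCompactSupport ψ ∧
      tsupport ψ ⊆ coordBox I ∧
      (∀ y, (∏ j, T' j (y j)) * ψ (coordMap T y) = T' i (y i) * φ y) ∧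
      ∀ y, (∏ j, T' j (y j)) * fderiv ℝ ψ (coordMap T y) (EuclideanSpace.single i 1) =
        fderiv ℝ φ y (EuclideanSpace.single i 1) := by
  classical
  -- The index `i` is omitted so that `P` does not depend on `x i`. Then the `i`-th derivative of
  -- `ψ₀` falls on `φ ∘ S` alone and supplies the missing factor `S' i`, completing the Jacobian of
  -- `S`, which cancels that of `T`.
  let P : EuclideanSpace ℝ (Fin n) → ℝ := fun x => ∏ j ∈ Finset.univ.erase i, S' j (x j)
  let ψ₀ : EuclideanSpace ℝ (Fin n) → ℝ := fun x => φ (coordMap S x) * P x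
  -- Extension by zero remains `C¹`: `ψ` vanishes off `K`, a compact subset of the open box.
  let ψ := (coordBox I).indicator ψ₀
  have hB : IsOpen (coordBox I) := isOpen_coordBox fun i => (h i).isOpen
  have hTB : ∀ y, coordMap T y ∈ coordBox I := fun y i => (h i).mem _
  have hST : ∀ y, coordMap S (coordMap T y) = y := coordMap_leftInverse h
  let K := coordMap T '' tsupport φ
  have hK : IsCompact K := hφc.isCompact.image (continuous_coordMap h)
  have hKB : K ⊆ coordBox I := by
    rintro _ ⟨y, -, rfl⟩
    exact hTB y
  have hψK : ∀ x, x ∉ K → ψ x = 0 := by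
    intro x hx
    by_cases hxB : x ∈ coordBox I
    · refine (indicator_of_mem hxB _).trans ?_
      have : coordMap S x ∉ tsupport φ := fun hs => hx ⟨_, hs, by
        ext i
        exact (h i).right_inv _ (hxB i)⟩
      simp only [ψ₀, image_eq_zero_of_notMem_tsupport this, zero_mul]
    · exact indicator_of_notMem hxB _
  have hts : tsupport ψ ⊆ K := closure_minimal
    (fun x hx => by by_contra hxK; exact hx (hψK x hxK)) hK.isClosed
  have hcoord : ∀ j : Fin n, ContDiff ℝ 1 fun x : EuclideanSpace ℝ (Fin n) => x j := fun j =>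
    (EuclideanSpace.proj (𝕜 := ℝ) j).contDiff
  have hψ₀ : ContDiffOn ℝ 1 ψ₀ (coordBox I) := by
    refine ContDiffOn.mul (hφ.comp_contDiffOn (contDiffOn_euclidean.2 fun j => ?_))
      (contDiffOn_prod fun j _ => ?_)
    · exact (h j).contDiffOn_inv.comp (hcoord j).contDiffOn fun x hx => hx j
    · exact (h j).contDiffOn_deriv_inv.comp (hcoord j).contDiffOn fun x hx => hx j
  have hev : ∀ x ∈ coordBox I, ψ =ᶠ[𝓝 x] ψ₀ := fun x hx => by
    filter_upwards [hB.mem_nhds hx] with z hz using indicator_of_mem hz _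
  have hψ : ContDiff ℝ 1 ψ := by
    rw [contDiff_iff_contDiffAt]
    intro x
    by_cases hx : x ∈ coordBox I
    · exact (hψ₀.contDiffAt (hB.mem_nhds hx)).congr_of_eventuallyEq (hev x hx)
    · have hxK : x ∉ K := fun hxK => hx (hKB hxK)
      refine (contDiffAt_const (c := (0 : ℝ))).congr_of_eventuallyEq ?_
      filter_upwards [hK.isClosed.isOpen_compl.mem_nhds hxK] with z hz using hψK z hz
  have hprod : ∀ y : EuclideanSpace ℝ (Fin n),
      (∏ j, T' j (y j)) * P (coordMap T y) = T' i (y i) := by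
    intro y
    rw [← Finset.mul_prod_erase _ _ (Finset.mem_univ i), mul_assoc, ← Finset.prod_mul_distrib]
    simp only [coordMap_apply, mul_comm (T' _ _) (S' _ _), (h _).deriv_inv_mul,
      Finset.prod_const_one, mul_one]
  refine ⟨ψ, hψ, hK.of_isClosed_subset (isClosed_tsupport _) hts, hts.trans hKB, fun y => ?_,
    fun y => ?_⟩
  · simp only [ψ, indicator_of_mem (hTB y), ψ₀, hST]
    rw [← hprod y]; ring
  · set x := coordMap T y
    set e : EuclideanSpace ℝ (Fin n) := EuclideanSpace.single i 1
    have h1 : HasDerivAt (fun s : ℝ => ψ (x + s • e)) (fderiv ℝ ψ x e) 0 :=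
      ((hψ.differentiable one_ne_zero) x).hasFDerivAt.hasLineDerivAt e
    have hline : HasDerivAt (fun s : ℝ => x + s • e) e 0 := by
      simpa using ((hasDerivAt_id (0 : ℝ)).smul_const e).const_add x
    have hSx : HasFDerivAt (coordMap S)
        (Matrix.toEuclideanCLM (𝕜 := ℝ) (Matrix.diagonal fun j => S' j (x j))) (x + (0 : ℝ) • e) := by
      simp only [zero_smul, add_zero]
      exact hasFDerivAt_coordMap fun j => (h j).hasDerivAt_inv _ (hTB y j)
    have hφx : HasFDerivAt φ (fderiv ℝ φ y) (coordMap S (x + (0 : ℝ) • e)) := by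
      simp only [zero_smul, add_zero, x, hST]
      exact ((hφ.differentiable one_ne_zero) y).hasFDerivAt
    have h2 := (hφx.comp_hasDerivAt (0 : ℝ) (hSx.comp_hasDerivAt (0 : ℝ) hline)).mul_const (P x)
    have h3 : HasDerivAt (fun s : ℝ => ψ (x + s • e)) (fderiv ℝ φ y (Matrix.toEuclideanCLM (𝕜 := ℝ)
        (Matrix.diagonal fun j => S' j (x j)) e) * P x) 0 := by
      refine h2.congr_of_eventuallyEq ?_
      have hx0 : ContinuousAt (fun s : ℝ => x + s • e) 0 := hline.continuousAt
      have hB0 : coordBox I ∈ 𝓝 (x + (0 : ℝ) • e) := by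
        rw [zero_smul, add_zero]
        exact hB.mem_nhds (hTB y)
      filter_upwards [hx0 hB0] with s hs
      refine (indicator_of_mem (show x + s • e ∈ coordBox I from hs) ψ₀).trans ?_
      simp only [ψ₀, Function.comp_apply]
      congr 1
      refine Finset.prod_congr rfl fun j hj => ?_
      simp [e, Finset.ne_of_mem_erase hj]
    rw [h1.unique h3]
    have h4 : Matrix.toEuclideanCLM (𝕜 := ℝ) (Matrix.diagonal fun j => S' j (x j)) e =
        S' i (x i) • e := by
      ext j
      simp only [Matrix.ofLp_toEuclideanCLM, Matrix.mulVec_diagonal, PiLp.smul_apply, e,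
        PiLp.single_apply, smul_eq_mul]
      by_cases hj : j = i
      · subst hj; simp
      · simp [hj]
    rw [h4, map_smul, smul_eq_mul]
    have h5 := hprod y
    have h6 : S' i (x i) * T' i (y i) = 1 := (h i).deriv_inv_mul (y i)
    linear_combination (S' i (x i) * fderiv ℝ φ y e) * h5 + fderiv ℝ φ y e * h6

/-- Weak gradients on a box pull back to weak gradients on the whole space under a coordinatewise
transport map. -/
lemma HasWeakGradient.comp_coordMap
    (h : ∀ i, IsGaussianTransport (ν i) (κ i) (I i) (T i) (T' i) (S i) (S' i))
    {f : EuclideanSpace ℝ (Fin n) → ℝ}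
    {g : EuclideanSpace ℝ (Fin n) → EuclideanSpace ℝ (Fin n)}
    (hw : HasWeakGradient (coordBox I) f g) :
    IsWeakGradientC1 (fun y => f (coordMap T y))
      (fun y => WithLp.toLp 2 fun i => T' i (y i) * g (coordMap T y) i) := by
  intro φ hφ hφc w
  have hB : IsOpen (coordBox I) := isOpen_coordBox fun i => (h i).isOpen
  have hgi : ∀ i, LocallyIntegrableOn (fun x => g x i) (coordBox I) := by
    intro i x hx
    obtain ⟨s, hs, hs'⟩ := hw.2.1 x hx
    exact ⟨s, hs, (EuclideanSpace.proj (𝕜 := ℝ) i).integrable_comp hs'⟩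
  have key : ∀ i : Fin n,
      Integrable (fun y => f (coordMap T y) * fderiv ℝ φ y (EuclideanSpace.single i 1)) ∧
      Integrable (fun y => T' i (y i) * g (coordMap T y) i * φ y) ∧
      ∫ y, f (coordMap T y) * fderiv ℝ φ y (EuclideanSpace.single i 1) =
        -∫ y, T' i (y i) * g (coordMap T y) i * φ y := by
    intro i
    obtain ⟨ψ, hψ, hψc, hψB, hψ1, hψ2⟩ := exists_pullback_test h hφ hφc i
    have i1 := integrableOn_mul_of_eq_zero_off hB hψc.isCompact hψB hw.1
      ((hψ.continuous_fderiv one_ne_zero).clm_apply continuous_const)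
      (u := fun x => fderiv ℝ ψ x (EuclideanSpace.single i 1)) (fun x hx => by
        rw [fderiv_of_notMem_tsupport ℝ hx]; rfl)
    have i2 := integrableOn_mul_of_eq_zero_off hB hψc.isCompact hψB (hgi i) hψ.continuous
      (fun x hx => image_eq_zero_of_notMem_tsupport hx)
    have i3 := hw.integral_eq_of_contDiff_one hB hψ hψc hψB i
    rw [integrableOn_coordBox_iff h] at i1 i2
    rw [integral_coordBox_eq h, integral_coordBox_eq h] at i3
    have e1 : ∀ y : EuclideanSpace ℝ (Fin n), (∏ i, T' i (y i)) * (f (coordMap T y) *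
        fderiv ℝ ψ (coordMap T y) (EuclideanSpace.single i 1)) =
        f (coordMap T y) * fderiv ℝ φ y (EuclideanSpace.single i 1) := by
      intro y; rw [← hψ2]; ring
    have e2 : ∀ y : EuclideanSpace ℝ (Fin n), (∏ i, T' i (y i)) * (g (coordMap T y) i *
        ψ (coordMap T y)) = T' i (y i) * g (coordMap T y) i * φ y := by
      intro y
      linear_combination g (coordMap T y) i * hψ1 y
    simp only [e1, e2] at i1 i2 i3
    exact ⟨i1, i2, i3⟩
  have hwsum : ∀ y, fderiv ℝ φ y w = ∑ i, w i * fderiv ℝ φ y (EuclideanSpace.single i 1) := by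
    intro y
    conv_lhs => rw [← (EuclideanSpace.basisFun (Fin n) ℝ).sum_repr w]
    simp
  have hL : ∀ y, f (coordMap T y) * fderiv ℝ φ y w =
      ∑ i, w i * (f (coordMap T y) * fderiv ℝ φ y (EuclideanSpace.single i 1)) := by
    intro y
    rw [hwsum, Finset.mul_sum]
    exact Finset.sum_congr rfl fun i _ => by ring
  have hR : ∀ y, ⟪(WithLp.toLp 2 fun i => T' i (y i) * g (coordMap T y) i :
      EuclideanSpace ℝ (Fin n)), w⟫ * φ y = ∑ i, w i * (T' i (y i) * g (coordMap T y) i * φ y) := by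
    intro y
    simp only [PiLp.inner_apply, RCLike.inner_apply, conj_trivial, Finset.sum_mul]
    exact Finset.sum_congr rfl fun i _ => by ring
  simp only [hL, hR]
  rw [integral_finsetSum _ fun i _ => (key i).1.const_mul _,
    integral_finsetSum _ fun i _ => (key i).2.1.const_mul _, ← Finset.sum_neg_distrib]
  refine Finset.sum_congr rfl fun i _ => ?_
  rw [integral_const_mul, integral_const_mul, (key i).2.2]
  ring

end BoxTransport

/-! ### Identification of the measure and of its domain. -/

section Law

open Set Filter Topology

variable {n : ℕ}

lemma isCountablySpanning_range_Iic : IsCountablySpanning (range (Iic : ℝ → Set ℝ)) := by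
  refine ⟨fun k : ℕ => Iic (k : ℝ), fun k => ⟨_, rfl⟩, ?_⟩
  ext x
  obtain ⟨k, hk⟩ := exists_nat_ge x
  simp only [mem_iUnion, mem_Iic, mem_univ, iff_true]
  exact ⟨k, hk⟩

/-- Probability measures on Euclidean space with the same joint distribution function coincide. -/
lemma ext_of_lower_orthants {μ ν : Measure (EuclideanSpace ℝ (Fin n))} [IsProbabilityMeasure μ]
    [IsProbabilityMeasure ν]
    (h : ∀ x : Fin n → ℝ, μ.real {y | ∀ i, y i ≤ x i} = ν.real {y | ∀ i, y i ≤ x i}) : μ = ν := by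
  let e : EuclideanSpace ℝ (Fin n) ≃ᵐ (Fin n → ℝ) := (MeasurableEquiv.toLp 2 (Fin n → ℝ)).symm
  have hμ : IsProbabilityMeasure (μ.map e) := Measure.isProbabilityMeasure_map e.measurable.aemeasurable
  have hν : IsProbabilityMeasure (ν.map e) := Measure.isProbabilityMeasure_map e.measurable.aemeasurable
  have key : μ.map e = ν.map e := by
    refine ext_of_generate_finite
      (pi univ '' pi univ fun _ : Fin n => range (Iic : ℝ → Set ℝ)) ?_
      (IsPiSystem.pi fun _ => by
        rintro _ ⟨a, rfl⟩ _ ⟨b, rfl⟩ -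
        exact ⟨a ⊓ b, Iic_inter_Iic.symm⟩) ?_ (by simp)
    · rw [← generateFrom_pi_eq fun _ => isCountablySpanning_range_Iic]
      exact congrArg (@MeasurableSpace.pi _ _) (funext fun _ =>
        BorelSpace.measurable_eq.trans (borel_eq_generateFrom_Iic ℝ))
    · rintro _ ⟨s, hs, rfl⟩
      choose x hx using fun i => hs i (mem_univ i)
      have hset : e ⁻¹' (pi univ s) = {y | ∀ i, y i ≤ x i} := by
        ext y
        simp only [mem_preimage, mem_univ_pi, ← hx, mem_Iic]
        rfl
      rw [e.map_apply, e.map_apply, hset]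
      have := h x
      rwa [measureReal_def, measureReal_def,
        ENNReal.toReal_eq_toReal_iff' (measure_ne_top _ _) (measure_ne_top _ _)] at this
  exact e.map_measurableEquiv_injective key

variable {κ : Fin n → ℝ} {I : Fin n → Set ℝ} {T T' S S' : Fin n → ℝ → ℝ}

/-- A measure with a Gaussian copula is the image of the Gaussian measure under the coordinatewise
transport map of the marginals. -/
lemma eq_map_multivariateGaussian {μ : Measure (EuclideanSpace ℝ (Fin n))}
    [IsProbabilityMeasure μ] {A : Matrix (Fin n) (Fin n) ℝ} (hcop : HasCopula μ (gaussianCopula A))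
    (h : ∀ i, IsGaussianTransport (marginal μ i) (κ i) (I i) (T i) (T' i) (S i) (S' i)) :
    μ = (multivariateGaussian 0 A).map (coordMap T) := by
  have hm : Measurable (coordMap T) := (continuous_coordMap h).measurable
  have : IsProbabilityMeasure ((multivariateGaussian 0 A).map (coordMap T)) :=
    Measure.isProbabilityMeasure_map hm.aemeasurable
  refine ext_of_lower_orthants fun x => ?_
  rw [hcop x, gaussianCopula, map_measureReal_apply hm]
  · congr 1
    ext y
    -- By `le_iff`, the event defining the copula at `F i (x i)` is the preimage of the orthant
    -- under `T`.
    simp only [mem_ofPred_eq, mem_preimage, coordMap_apply, (h _).le_iff]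
  · have : {y : EuclideanSpace ℝ (Fin n) | ∀ i, y i ≤ x i} = ⋂ i, {y | y i ≤ x i} := by
      ext; simp
    rw [this]
    exact MeasurableSet.iInter fun i => measurableSet_le (by fun_prop) (by fun_prop)

lemma convex_coordBox (hI : ∀ i, (I i).OrdConnected) : Convex ℝ (coordBox I) := by
  intro x hx y hy a b ha hb hab i
  exact (hI i).convex (hx i) (hy i) ha hb hab

/-- This is where the positivity of the density on `Ω` enters. -/
lemma MemProbClass.restrict_absolutelyContinuous {Ω : Set (EuclideanSpace ℝ (Fin n))}
    (hΩ : IsOpen Ω) {μ : Measure (EuclideanSpace ℝ (Fin n))} (hμ : MemProbClass Ω μ) :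
    volume.restrict Ω ≪ μ := by
  obtain ⟨-, ρ, hρm, hρ, rfl⟩ := hμ
  refine withDensity_absolutelyContinuous' hρm.ennreal_ofReal.aemeasurable ?_
  filter_upwards [ae_restrict_mem hΩ.measurableSet] with x hx
  exact (ENNReal.ofReal_pos.2 (hρ x hx)).ne'

lemma MemProbClass.absolutelyContinuous {Ω : Set (EuclideanSpace ℝ (Fin n))}
    {μ : Measure (EuclideanSpace ℝ (Fin n))} (hμ : MemProbClass Ω μ) :
    μ ≪ volume.restrict Ω := by
  obtain ⟨-, ρ, -, -, rfl⟩ := hμ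
  exact withDensity_absolutelyContinuous _ _

/-- If `μ` is the image of a measure charging all open sets, its domain is the range box. -/
lemma eq_coordBox {Ω : Set (EuclideanSpace ℝ (Fin n))} (hΩ : IsOpen Ω)
    (hreg : interior (closure Ω) = Ω) {μ γ : Measure (EuclideanSpace ℝ (Fin n))}
    [γ.IsOpenPosMeasure] {ν : Fin n → Measure ℝ} (hμ : MemProbClass Ω μ)
    (h : ∀ i, IsGaussianTransport (ν i) (κ i) (I i) (T i) (T' i) (S i) (S' i))
    (hmap : μ = γ.map (coordMap T)) : Ω = coordBox I := by
  have hcont := continuous_coordMap h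
  have hB : IsOpen (coordBox I) := isOpen_coordBox fun i => (h i).isOpen
  have hTB : ∀ y, coordMap T y ∈ coordBox I := fun y i => (h i).mem _
  apply Subset.antisymm
  -- `Ω` minus the closed box is open and Lebesgue-null, hence empty; an open convex box is the
  -- interior of its closure.
  · have hnull : μ (coordBox I)ᶜ = 0 := by
      rw [hmap, Measure.map_apply hcont.measurable hB.measurableSet.compl]
      convert! measure_empty (μ := γ)
      ext y
      simp [hTB]
    have h1 : (volume.restrict Ω) (coordBox I)ᶜ = 0 := hμ.restrict_absolutelyContinuous hΩ hnull
    have h2 : volume ((closure (coordBox I))ᶜ ∩ Ω) = 0 := by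
      rw [Measure.restrict_apply hB.measurableSet.compl] at h1
      exact measure_mono_null (inter_subset_inter_left _ (compl_subset_compl.2 subset_closure)) h1
    have h3 := (isClosed_closure.isOpen_compl.inter hΩ).eq_empty_of_measure_zero h2
    have h4 : Ω ⊆ closure (coordBox I) := fun x hx => by
      by_contra hx'
      exact (eq_empty_iff_forall_notMem.1 h3 x) ⟨hx', hx⟩
    have h5 : interior (closure (coordBox I)) = coordBox I := by
      rw [(convex_coordBox fun i => (h i).ordConnected).interior_closure_eq_interior_of_nonempty_interior
        (by rw [hB.interior_eq]; exact ⟨_, hTB 0⟩), hB.interior_eq]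
    rw [← h5]
    exact interior_maximal h4 hΩ
  -- The preimage under `T` of the complement of `closure Ω` is open and `γ`-null, hence empty. So
  -- the box lies in `closure Ω`, and the regularity of `Ω` concludes.
  · have hnull : μ (closure Ω)ᶜ = 0 := by
      refine hμ.absolutelyContinuous ?_
      rw [Measure.restrict_apply isClosed_closure.measurableSet.compl]
      convert! measure_empty (μ := (volume : Measure (EuclideanSpace ℝ (Fin n))))
      exact disjoint_iff_inter_eq_empty.1
        (disjoint_compl_left_iff_subset.2 subset_closure)
    rw [hmap, Measure.map_apply hcont.measurable isClosed_closure.measurableSet.compl] at hnull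
    have h3 := (isClosed_closure.isOpen_compl.preimage hcont).eq_empty_of_measure_zero hnull
    rw [← hreg]
    refine interior_maximal ?_ hB
    rw [← image_coordMap_univ h]
    rintro _ ⟨y, -, rfl⟩
    by_contra hy
    exact (eq_empty_iff_forall_notMem.1 h3 y) hy

instance : (stdGaussian (EuclideanSpace ℝ (Fin n))).IsOpenPosMeasure := by
  refine Measure.AbsolutelyContinuous.isOpenPosMeasure
    (μ := (volume : Measure (EuclideanSpace ℝ (Fin n)))) ?_
  rw [stdGaussian_eq_withDensity]
  refine withDensity_absolutelyContinuous'
    (continuous_gaussianDensity.measurable.ennreal_ofReal.aemeasurable) (.of_forall fun x => ?_)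
  exact (ENNReal.ofReal_pos.2 (gaussianDensity_pos x)).ne'

end Law

/-! ### Largest eigenvalue and square root of the covariance matrix. -/

section Spectral

open scoped RealInnerProductSpace MatrixOrder

variable {n : ℕ} {A : Matrix (Fin n) (Fin n) ℝ}

lemma eigenvalues_le_lambdaMax (hA : A.IsHermitian) (i : Fin n) :
    hA.eigenvalues i ≤ lambdaMax A :=
  le_csSup Matrix.finite_real_spectrum.bddAbove (hA.eigenvalues_mem_spectrum_real i)

lemma lambdaMax_pos (hn : 1 ≤ n) (hA : A.PosDef) : 0 < lambdaMax A :=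
  (hA.eigenvalues_pos ⟨0, hn⟩).trans_le (eigenvalues_le_lambdaMax hA.1 _)

lemma toEuclideanCLM_inner_symm (hA : A.IsHermitian) (x y : EuclideanSpace ℝ (Fin n)) :
    ⟪Matrix.toEuclideanCLM (𝕜 := ℝ) A x, y⟫ = ⟪x, Matrix.toEuclideanCLM (𝕜 := ℝ) A y⟫ := by
  rw [← ContinuousLinearMap.adjoint_inner_right]
  congr 2
  have : star (Matrix.toEuclideanCLM (𝕜 := ℝ) A) = Matrix.toEuclideanCLM (𝕜 := ℝ) A := by
    rw [← map_star, Matrix.star_eq_conjTranspose, hA.eq]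
  rwa [ContinuousLinearMap.star_eq_adjoint] at this

/-- Expand `v` in an orthonormal eigenbasis and bound each eigenvalue. -/
lemma inner_toEuclideanCLM_le (hA : A.IsHermitian) (v : EuclideanSpace ℝ (Fin n)) :
    ⟪v, Matrix.toEuclideanCLM (𝕜 := ℝ) A v⟫ ≤ lambdaMax A * ‖v‖ ^ 2 := by
  set b := hA.eigenvectorBasis
  have hb : ∀ i, Matrix.toEuclideanCLM (𝕜 := ℝ) A (b i) = hA.eigenvalues i • b i := by
    intro i
    ext j
    rw [Matrix.ofLp_toEuclideanCLM, hA.mulVec_eigenvectorBasis]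
    rfl
  rw [← b.sum_inner_mul_inner, ← b.sum_sq_inner_right, Finset.mul_sum]
  refine Finset.sum_le_sum fun i _ => ?_
  rw [← toEuclideanCLM_inner_symm hA, hb, real_inner_smul_left, real_inner_comm]
  have := eigenvalues_le_lambdaMax hA i
  nlinarith [sq_nonneg ⟪b i, v⟫]

lemma isHermitian_sqrt : (CFC.sqrt A).IsHermitian :=
  (CFC.sqrt_nonneg A).isSelfAdjoint

/-- Self-adjointness of `√A` gives `‖√A v‖² = ⟪v, A v⟫`. -/
lemma norm_sqrt_sq_le (hA : A.PosDef) (v : EuclideanSpace ℝ (Fin n)) :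
    ‖Matrix.toEuclideanCLM (𝕜 := ℝ) (CFC.sqrt A) v‖ ^ 2 ≤ lambdaMax A * ‖v‖ ^ 2 := by
  rw [← real_inner_self_eq_norm_sq, toEuclideanCLM_inner_symm isHermitian_sqrt,
    ← ContinuousLinearMap.comp_apply, ← ContinuousLinearMap.mul_def, ← map_mul,
    CFC.sqrt_mul_sqrt_self _ hA.posSemidef.nonneg]
  exact inner_toEuclideanCLM_le hA.1 v

/-- A nondegenerate centered Gaussian measure is the image of the standard one under a self-adjoint
linear equivalence (the square root of its covariance matrix). -/
lemma exists_map_stdGaussian_eq (hA : A.PosDef) :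
    ∃ M : EuclideanSpace ℝ (Fin n) ≃L[ℝ] EuclideanSpace ℝ (Fin n),
      multivariateGaussian 0 A = (stdGaussian (EuclideanSpace ℝ (Fin n))).map M ∧
      (∀ x y, ⟪M x, y⟫ = ⟪x, M y⟫) ∧ ∀ v, ‖M v‖ ^ 2 ≤ lambdaMax A * ‖v‖ ^ 2 := by
  have hdet : IsUnit (CFC.sqrt A).det := by
    have h1 : CFC.sqrt A * CFC.sqrt A = A := CFC.sqrt_mul_sqrt_self _ hA.posSemidef.nonneg
    have h2 := congrArg Matrix.det h1
    rw [Matrix.det_mul] at h2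
    have h3 := hA.det_pos
    rw [← h2] at h3
    exact isUnit_iff_ne_zero.2 fun h0 => by simp [h0] at h3
  refine ⟨ContinuousLinearEquiv.equivOfInverse (Matrix.toEuclideanCLM (𝕜 := ℝ) (CFC.sqrt A))
    (Matrix.toEuclideanCLM (𝕜 := ℝ) (CFC.sqrt A)⁻¹) (fun x => ?_) (fun x => ?_), ?_,
    fun x y => toEuclideanCLM_inner_symm isHermitian_sqrt x y, fun v => norm_sqrt_sq_le hA v⟩
  · rw [← ContinuousLinearMap.comp_apply, ← ContinuousLinearMap.mul_def, ← map_mul,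
      Matrix.nonsing_inv_mul _ hdet]
    simp
  · rw [← ContinuousLinearMap.comp_apply, ← ContinuousLinearMap.mul_def, ← map_mul,
      Matrix.mul_nonsing_inv _ hdet]
    simp
  · rw [multivariateGaussian]
    congr 1
    ext z
    simp

end Spectral

/-! ### Poincaré constant of the transported measure. -/

section Poincare

open Set Filter Topology
open scoped RealInnerProductSpace

variable {n : ℕ}

/-- Smooth functions have their classical partial derivatives as weak ones. -/
lemma hasWeakGradient_comp_apply {Ω : Set (EuclideanSpace ℝ (Fin n))} {u u' : ℝ → ℝ}
    (hu : ∀ t, HasDerivAt u (u' t) t) (hu' : Continuous u') (i : Fin n) :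
    HasWeakGradient Ω (fun x => u (x i)) (fun x => EuclideanSpace.single i (u' (x i))) := by
  have hi : Continuous fun x : EuclideanSpace ℝ (Fin n) => x i := by fun_prop
  have huc : Continuous u := continuous_iff_continuousAt.2 fun t => (hu t).continuousAt
  have hf : Continuous fun x : EuclideanSpace ℝ (Fin n) => u (x i) := huc.comp hi
  have hg : Continuous fun x : EuclideanSpace ℝ (Fin n) =>
      (EuclideanSpace.single i (u' (x i)) : EuclideanSpace ℝ (Fin n)) := by
    have e : (fun x : EuclideanSpace ℝ (Fin n) =>
        (EuclideanSpace.single i (u' (x i)) : EuclideanSpace ℝ (Fin n))) =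
        fun x => u' (x i) • EuclideanSpace.single i (1 : ℝ) := by
      ext x j
      simp
    rw [e]
    exact (hu'.comp hi).smul continuous_const
  refine ⟨hf.locallyIntegrable.locallyIntegrableOn _, hg.locallyIntegrable.locallyIntegrableOn _,
    fun φ hφ hφc hφΩ j => ?_⟩
  have hfd : ∀ x : EuclideanSpace ℝ (Fin n), HasFDerivAt (fun x : EuclideanSpace ℝ (Fin n) => u (x i))
      (u' (x i) • (EuclideanSpace.proj i : EuclideanSpace ℝ (Fin n) →L[ℝ] ℝ)) x := fun x =>
    (hu (x i)).comp_hasFDerivAt x (EuclideanSpace.proj (𝕜 := ℝ) i).hasFDerivAt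
  have hfe : ∀ x : EuclideanSpace ℝ (Fin n), fderiv ℝ (fun x : EuclideanSpace ℝ (Fin n) => u (x i)) x
      (EuclideanSpace.single j 1) = (EuclideanSpace.single i (u' (x i)) :
      EuclideanSpace ℝ (Fin n)) j := by
    intro x
    rw [(hfd x).fderiv]
    by_cases hij : i = j
    · subst hij; simp
    · simp [hij, Ne.symm hij]
  have hgj : Continuous fun x : EuclideanSpace ℝ (Fin n) =>
      (EuclideanSpace.single i (u' (x i)) : EuclideanSpace ℝ (Fin n)) j :=
    (EuclideanSpace.proj (𝕜 := ℝ) j).continuous.comp hg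
  have hφ' : Continuous fun x => fderiv ℝ φ x (EuclideanSpace.single j 1) :=
    (hφ.continuous_fderiv (by simp)).clm_apply continuous_const
  rw [setIntegral_eq_integral_of_forall_compl_eq_zero fun x hx => ?_,
    setIntegral_eq_integral_of_forall_compl_eq_zero fun x hx => ?_]
  · have := integral_mul_fderiv_eq_neg_fderiv_mul_of_integrable (μ := volume)
      (f := fun x : EuclideanSpace ℝ (Fin n) => u (x i)) (g := φ) (v := EuclideanSpace.single j 1)
      ?_ ?_ ?_ (fun x _ => (hfd x).differentiableAt)
      (fun x _ => (hφ.differentiable (by simp)) x)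
    · simpa only [hfe] using this
    · simp only [hfe]
      exact (hgj.mul hφ.continuous).integrable_of_hasCompactSupport hφc.mul_left
    · exact (hf.mul hφ').integrable_of_hasCompactSupport (hφc.fderiv_apply (𝕜 := ℝ) _).mul_left
    · exact (hf.mul hφ.continuous).integrable_of_hasCompactSupport hφc.mul_left
  · rw [image_eq_zero_of_notMem_tsupport fun hx' => hx (hφΩ hx'), mul_zero]
  · rw [fderiv_of_notMem_tsupport ℝ fun hx' => hx (hφΩ hx')]
    simp

/-- A measure with a positive density on an open set admits a test function with positive variance
and finite energy. -/
lemma exists_variance_pos (hn : 1 ≤ n) {Ω : Set (EuclideanSpace ℝ (Fin n))} (hΩ : IsOpen Ω)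
    (hne : Ω.Nonempty) {μ : Measure (EuclideanSpace ℝ (Fin n))} (hμ : MemProbClass Ω μ) :
    ∃ f g, MemLp f 2 μ ∧ HasWeakGradient Ω f g ∧ Integrable (fun x => ‖g x‖ ^ 2) μ ∧
      0 < variance f μ := by
  have : IsProbabilityMeasure μ := hμ.1
  let i : Fin n := ⟨0, hn⟩
  have hi : Continuous fun x : EuclideanSpace ℝ (Fin n) => x i := by fun_prop
  -- The arctangent is bounded, injective and has a bounded derivative, so it is admissible without
  -- any moment assumption.
  let f : EuclideanSpace ℝ (Fin n) → ℝ := fun x => Real.arctan (x i)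
  have hfc : Continuous f := Real.continuous_arctan.comp hi
  have hu' : Continuous fun t : ℝ => 1 / (1 + t ^ 2) :=
    continuous_const.div (by fun_prop) fun t => by positivity
  have hf2 : MemLp f 2 μ := by
    refine MemLp.of_bound hfc.aestronglyMeasurable (Real.pi / 2) (.of_forall fun x => ?_)
    rw [Real.norm_eq_abs, abs_le]
    exact ⟨(Real.neg_pi_div_two_lt_arctan _).le, (Real.arctan_lt_pi_div_two _).le⟩
  refine ⟨f, _, hf2, hasWeakGradient_comp_apply (fun t => Real.hasDerivAt_arctan t) hu' i, ?_, ?_⟩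
  · have e : ∀ x : EuclideanSpace ℝ (Fin n), ‖(EuclideanSpace.single i (1 / (1 + x i ^ 2)) :
        EuclideanSpace ℝ (Fin n))‖ ^ 2 = (1 / (1 + x i ^ 2)) ^ 2 := by
      intro x; simp
    simp only [e]
    refine Integrable.of_bound (((hu'.comp hi).pow 2).aestronglyMeasurable) 1
      (.of_forall fun x => ?_)
    rw [Real.norm_of_nonneg (by positivity)]
    refine pow_le_one₀ (by positivity) ?_
    rw [div_le_one (by positivity)]
    nlinarith [sq_nonneg (x i)]
  · refine lt_of_le_of_ne (variance_nonneg f μ) fun h0 => ?_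
    rw [variance_eq_integral hf2.aestronglyMeasurable.aemeasurable] at h0
    have h1 := (integral_eq_zero_iff_of_nonneg (fun x => sq_nonneg _)
      ((hf2.sub (memLp_const _)).integrable_sq)).1 h0.symm
    have h2 := hμ.restrict_absolutelyContinuous hΩ h1
    have h3 : f =ᵐ[volume.restrict Ω] fun _ => ∫ x, f x ∂μ := by
      filter_upwards [h2] with x hx
      exact sub_eq_zero.1 (pow_eq_zero_iff two_ne_zero |>.1 hx)
    -- By continuity `f` is constant everywhere on `Ω`, which fails when moving slightly along the
    -- `i`-th axis.
    have h4 := Measure.eqOn_open_of_ae_eq h3 hΩ hfc.continuousOn continuousOn_const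
    obtain ⟨x, hx⟩ := hne
    have hline : ContinuousAt (fun s : ℝ => x + s • (EuclideanSpace.single i 1 :
        EuclideanSpace ℝ (Fin n))) 0 := by fun_prop
    have hΩ0 : Ω ∈ 𝓝 (x + (0 : ℝ) • (EuclideanSpace.single i 1 : EuclideanSpace ℝ (Fin n))) := by
      rw [zero_smul, add_zero]; exact hΩ.mem_nhds hx
    obtain ⟨s, hs, hs0⟩ : ∃ s : ℝ, x + s • (EuclideanSpace.single i 1 :
        EuclideanSpace ℝ (Fin n)) ∈ Ω ∧ s ≠ 0 := by
      have h5 : ∀ᶠ s in 𝓝[≠] (0 : ℝ), x + s • (EuclideanSpace.single i 1 :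
          EuclideanSpace ℝ (Fin n)) ∈ Ω := (hline.eventually hΩ0).filter_mono nhdsWithin_le_nhds
      exact (h5.and self_mem_nhdsWithin).exists
    have h6 := Real.arctan_injective ((h4 hs).trans (h4 hx).symm)
    simp at h6
    exact hs0 h6

/-- The infimum of the admissible constants is admissible, as soon as one constant is. -/
lemma SatisfiesPoincare.poincareConstant (hn : 1 ≤ n) {Ω : Set (EuclideanSpace ℝ (Fin n))}
    (hΩ : IsOpen Ω) (hne : Ω.Nonempty) {μ : Measure (EuclideanSpace ℝ (Fin n))}
    (hμ : MemProbClass Ω μ) {C : ℝ} (hC : SatisfiesPoincare Ω μ C) :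
    SatisfiesPoincare Ω μ (poincareConstant Ω μ) ∧ poincareConstant Ω μ ≤ C := by
  have hbdd : BddBelow {C : ℝ | SatisfiesPoincare Ω μ C} := ⟨0, fun c hc => hc.1.le⟩
  refine ⟨⟨?_, fun f g hf hg hgi => ?_⟩, csInf_le hbdd hC⟩
  -- Every admissible constant is at least the Rayleigh quotient of this test function, so the
  -- infimum is positive.
  · obtain ⟨f, g, hf, hg, hgi, hpos⟩ := exists_variance_pos hn hΩ hne hμ
    have hD : 0 < ∫ x, ‖g x‖ ^ 2 ∂μ := by
      have h1 := hpos.trans_le (hC.2 f g hf hg hgi)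
      exact (mul_pos_iff_of_pos_left hC.1).1 h1
    exact (div_pos hpos hD).trans_le
      (le_csInf ⟨C, hC⟩ fun c hc => (div_le_iff₀ hD).2 (hc.2 f g hf hg hgi))
  · have hD : 0 ≤ ∫ x, ‖g x‖ ^ 2 ∂μ := integral_nonneg fun x => by positivity
    -- With zero energy the constant is irrelevant and the inequality for `C` suffices; otherwise,
    -- divide by the energy and pass to the infimum.
    rcases hD.eq_or_lt with h0 | hD
    · have := hC.2 f g hf hg hgi
      rw [← h0, mul_zero] at this ⊢
      exact this
    · rw [← div_le_iff₀ hD]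
      exact le_csInf ⟨C, hC⟩ fun c hc => (div_le_iff₀ hD).2 (hc.2 f g hf hg hgi)

variable {ν : Fin n → Measure ℝ} {κ : Fin n → ℝ} {I : Fin n → Set ℝ} {T T' S S' : Fin n → ℝ → ℝ}

/-- The Poincaré inequality for the image of a Gaussian measure under a coordinatewise
transport. -/
lemma satisfiesPoincare_map (hn : 1 ≤ n) {A : Matrix (Fin n) (Fin n) ℝ} (hA : A.PosDef)
    (hκ : ∀ i, 0 < κ i)
    (h : ∀ i, IsGaussianTransport (ν i) (κ i) (I i) (T i) (T' i) (S i) (S' i))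
    (hac : (multivariateGaussian 0 A).map (coordMap T) ≪ volume.restrict (coordBox I)) :
    SatisfiesPoincare (coordBox I) ((multivariateGaussian 0 A).map (coordMap T))
      (lambdaMax A * ⨆ i, 1 / κ i) := by
  have hbdd : BddAbove (range fun i => 1 / κ i) := (finite_range _).bddAbove
  have hsup : ∀ i, 1 / κ i ≤ ⨆ i, 1 / κ i := fun i => le_ciSup hbdd i
  have hsup0 : 0 < ⨆ i, 1 / κ i := (one_div_pos.2 (hκ ⟨0, hn⟩)).trans_le (hsup ⟨0, hn⟩)
  have hl := lambdaMax_pos hn hA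
  obtain ⟨M, hM, hMsymm, hMle⟩ := exists_map_stdGaussian_eq hA
  set γ := stdGaussian (EuclideanSpace ℝ (Fin n))
  let P : EuclideanSpace ℝ (Fin n) → EuclideanSpace ℝ (Fin n) := fun z => coordMap T (M z)
  have hTc := continuous_coordMap h
  have hP : Continuous P := hTc.comp M.continuous
  have hmap : (multivariateGaussian 0 A).map (coordMap T) = γ.map P := by
    rw [hM, Measure.map_map hTc.measurable M.continuous.measurable]
    rfl
  rw [hmap] at hac ⊢
  refine ⟨mul_pos hl hsup0, fun f g hf hw hg => ?_⟩
  have hmp : MeasurePreserving P γ (γ.map P) := ⟨hP.measurable, rfl⟩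
  have hB : IsOpen (coordBox I) := isOpen_coordBox fun i => (h i).isOpen
  -- The measurability of `g` is known only for Lebesgue measure on the box; absolute continuity
  -- transfers it.
  have hgm : AEStronglyMeasurable g (γ.map P) :=
    (hw.2.1.aestronglyMeasurable).mono_ac hac
  let v : EuclideanSpace ℝ (Fin n) → EuclideanSpace ℝ (Fin n) := fun y => WithLp.toLp 2 fun i => T' i (y i) * g (coordMap T y) i
  have hwG : IsWeakGradientC1 (fun z => f (P z))
      (fun z => M (v (M z))) :=
    (hw.comp_coordMap h).comp_linear M M hMsymm
  -- The constant appears here: `M` contributes `lambdaMax A`, and the squared derivatives of the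
  -- transports contribute `1 / κ i`.
  have hbound : ∀ z, ‖M (v (M z))‖ ^ 2 ≤
      lambdaMax A * (⨆ i, 1 / κ i) * ‖g (P z)‖ ^ 2 := by
    intro z
    refine (hMle _).trans ?_
    rw [mul_assoc]
    refine mul_le_mul_of_nonneg_left ?_ hl.le
    rw [EuclideanSpace.real_norm_sq_eq, EuclideanSpace.real_norm_sq_eq, Finset.mul_sum]
    refine Finset.sum_le_sum fun i _ => ?_
    simp only [v, mul_pow]
    exact mul_le_mul_of_nonneg_right (((h i).deriv_sq_le _).trans (hsup i)) (sq_nonneg _)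
  have hgP : Integrable (fun z => ‖g (P z)‖ ^ 2) γ := hmp.integrable_comp_of_integrable hg
  have hT'm : ∀ i, Measurable (T' i) := fun i => by
    rw [show T' i = deriv (T i) from funext fun y => ((h i).hasDerivAt y).deriv.symm]
    exact measurable_deriv _
  have hGm : AEStronglyMeasurable
      (fun z => M (v (M z))) γ := by
    refine M.continuous.comp_aestronglyMeasurable ?_
    refine (PiLp.continuous_toLp 2 _).comp_aestronglyMeasurable ?_
    have hgPm : AEMeasurable (fun z => g (P z)) γ :=
      (hgm.comp_measurePreserving hmp).aemeasurable
    refine (aemeasurable_pi_lambda _ fun i => ?_).aestronglyMeasurable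
    have h1 : AEMeasurable (fun z => g (P z) i) γ :=
      (by fun_prop : Measurable fun x : EuclideanSpace ℝ (Fin n) => x i).comp_aemeasurable hgPm
    have h2 : Measurable fun z => T' i (M z i) :=
      (hT'm i).comp ((by fun_prop : Measurable fun x : EuclideanSpace ℝ (Fin n) => x i).comp M.continuous.measurable)
    exact h2.aemeasurable.mul h1
  have hG : MemLp (fun z => M (v (M z))) 2 γ := by
    rw [memLp_two_iff_integrable_sq_norm hGm]
    refine (hgP.const_mul (lambdaMax A * ⨆ i, 1 / κ i)).mono' (hGm.norm.pow 2)
      (.of_forall fun z => ?_)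
    rw [Real.norm_of_nonneg (by positivity)]
    exact hbound z
  have hvar := variance_stdGaussian_le hwG (hf.comp_measurePreserving hmp) hG
  rw [variance_map hf.aestronglyMeasurable.aemeasurable hP.measurable.aemeasurable,
    integral_map hP.measurable.aemeasurable hg.aestronglyMeasurable, ← integral_const_mul]
  refine hvar.trans (integral_mono (hG.integrable_norm_pow two_ne_zero) (hgP.const_mul _) hbound)

end Poincare

theorem mainTheorem6 {n : ℕ} (hn : 1 ≤ n)
    (Ω : Set (EuclideanSpace ℝ (Fin n))) (hΩ_open : IsOpen Ω) (hΩ_conn : IsConnected Ω)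
    (hΩ_reg : interior (closure Ω) = Ω)
    (μ : MeasureTheory.Measure (EuclideanSpace ℝ (Fin n))) (hμ : MemProbClass Ω μ)
    (A : Matrix (Fin n) (Fin n) ℝ) (hA : IsCorrelationMatrix A)
    (hcop : HasCopula μ (gaussianCopula A))
    (κ : Fin n → ℝ) (hκ : ∀ i, 0 < κ i)
    (hmarg : ∀ i, HasLogConcaveDensity (marginal μ i) (κ i)) :
    SatisfiesPoincare Ω μ (poincareConstant Ω μ) ∧
      poincareConstant Ω μ ≤ lambdaMax A * ⨆ i, 1 / κ i := by
  have : IsProbabilityMeasure μ := hμ.1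
  have hprob : ∀ i, IsProbabilityMeasure (marginal μ i) := fun i =>
    Measure.isProbabilityMeasure_map (by fun_prop)
  choose I T T' S S' h using fun i => exists_isGaussianTransport (marginal μ i) (hκ i) (hmarg i)
  have hmap := eq_map_multivariateGaussian hcop h
  obtain ⟨M, hM, -, -⟩ := exists_map_stdGaussian_eq hA.1
  have hpos : (multivariateGaussian 0 A).IsOpenPosMeasure := by
    rw [hM]
    exact M.continuous.isOpenPosMeasure_map M.surjective
  -- Once `Ω` is known to be the box, any weak gradient on `Ω` pulls back to one on the whole space,
  -- and it remains to exhibit one admissible constant.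
  have hbox := eq_coordBox hΩ_open hΩ_reg hμ h hmap
  refine SatisfiesPoincare.poincareConstant hn hΩ_open hΩ_conn.nonempty hμ ?_
  have hac := hμ.absolutelyContinuous
  rw [hbox, hmap] at hac ⊢
  exact satisfiesPoincare_map hn hA.1 hκ h hac
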